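/- Let $A=(a_{ij})_{i,j\in I}$ be a symmetrizable generalized Cartan matrix over a finite index set $I$ with $n$ elements and let $l$ be its rank: $a_{ij}\in\mathbb Z$, $a_{ii}=2$, $a_{ij}\le 0$ for $i\neq j$, $a_{ij}=0\iff a_{ji}=0$, and $A=DB$ with $D$ a diagonal matrix with positive rational entries and $B$ a symmetric rational matrix. Fix a simply connected minimal free realization of $A$: a free $\mathbb Z$-module $H$ of rank $2n-l$ with dual $P=\mathrm{Hom}(H,\mathbb Z)$, and linearly independent families $(h_i)_{i\in I}$ in $H$ and $(\alpha_i)_{i\in I}$ in $P$ with $\alpha_i(h_j)=a_{ji}$, such that there are $\Lambda_i\in P$ with $\Lambda_i(h_j)=\delta_{ij}$. Let $\mathcal W$ be the Weyl group of $A$, that is, the Coxeter group with generators $\sigma_i$ ($i\in I$), $\sigma_i^2=1$, and $(\sigma_i\sigma_j)^{m_{ij}}=1$ for $i\ne j$, where $m_{ij}=2,3,4,6$ if $a_{ij}a_{ji}=0,1,2,3$ and there is no relation if $a_{ij}a_{ji}\geq 4$. It acts on $\mathbf h^*_{\mathbb R}=\mathrm{Hom}(H,\mathbb R)$ by $\sigma_i\lambda=\lambda-\lambda(h_i)\alpha_i$.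 Let $\overline C=\{\lambda\in \mathbf h_{\mathbb R}^* : \lambda(h_i)\ge 0 \text{ for all } i\in I\}$ and let $X=\mathcal W\,\overline C$ be the Tits cone. A face of $X$ is a non-empty convex subset $R\subseteq X$ such that whenever $x,y\in X$ and the open segment between $x$ and $y$ meets $R$, then $x,y\in R$. The Weyl monoid $\widehat{\mathcal W}$ is the set of pairs $(R,\sigma)$, with $R$ a face of $X$ and $\sigma\in\mathcal W$, with the multiplication $(R,\sigma)(S,\tau)=(R\cap\sigma S,\sigma\tau)$, modulo the congruence relation $(R,\sigma)\sim(R',\sigma')$ iff $R=R'$ and $\sigma'\sigma^{-1}$ fixes $R$ pointwise. Write $e(R)$ for the class of $(R,1)$, and identify $w\in\mathcal W$ with the class of $(X,w)$. A set $\Theta\subseteq I$ is special if it is empty or every connected component of $(a_{ij})_{i,j\in\Theta}$ is of non-finite type, where an indecomposable real square matrix $M$ is of finite type if $\det M\ne0$, there is a vector $u>0$ with $Mu>0$, and $Mv\ge0$ implies $v>0$ or $v=0$ (entrywise inequalities). Set $\Theta^\bot=\{i\in I: a_{ij}=0\text{ for all }j\in\Theta\}$ and $R(\Theta)=\{\lambda\in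 X:\lambda(h_i)=0\text{ for all }i\in\Theta\}$. For $J\subseteq I$ let $\mathcal W_J$ be the subgroup generated by the $\sigma_i$, $i\in J$, and let $\mathcal W^J$ and ${}^J\mathcal W$ be the sets of those elements $w$ of $\mathcal W$ that have minimal length in their coset $w\mathcal W_J$ and $\mathcal W_Jw$, respectively. **Proposition.** The Tits cone $X$ is a face of itself (that is, $X$ is convex), and $R(\Theta)$ is a face of $X$ for every special $\Theta$. Let $\hat w\in\widehat{\mathcal W}$. (I) There exist a uniquely determined special set $\Theta$ and uniquely determined elements $w_1\in\mathcal W^{\Theta}$, $w_2\in{}^{\Theta\cup\Theta^\bot}\mathcal W$ such that $\hat w=w_1e(R(\Theta))w_2$. (II) There exist a uniquely determined special set $\Theta$ and uniquely determined elements $w_1\in\mathcal W^{\Theta\cup\Theta^\bot}$, $w_2\in{}^{\Theta}\mathcal W$ such that $\hat w=w_1e(R(\Theta))w_2$. (III) There exist a uniquely determined special set $\Theta$ and uniquely determined elements $w_1\in\mathcal W^{\Theta\cup\Theta^\bot}$, $w_2\in\mathcal W_{\Theta^\bot}$, $w_3\in{}^{\Theta\cup\Theta^\bot}\mathcal W$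 such that $\hat w=w_1w_2e(R(\Theta))w_3$. Moreover $w_1w_2e(R(\Theta))w_3=w_1e(R(\Theta))w_2w_3$ for all special $\Theta$ and all such $w_1,w_2,w_3$. Finally, for every special $\Theta$ the multiplication of $\mathcal W$ restricts to bijections $\mathcal W^{\Theta\cup\Theta^\bot}\times\mathcal W_{\Theta^\bot}\to\mathcal W^{\Theta}$ and $\mathcal W_{\Theta^\bot}\times{}^{\Theta\cup\Theta^\bot}\mathcal W\to{}^{\Theta}\mathcal W$. -/

import Mathlib

/-- A generalized Cartan matrix with rows and columns indexed by the finite set `ι`. -/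
structure GCM (ι : Type*) where
  /-- The entries `a i j`. -/
  a : Matrix ι ι ℤ
  diag : ∀ i, a i i = 2
  nonpos : ∀ i j, i ≠ j → a i j ≤ 0
  zero_iff : ∀ i j, a i j = 0 ↔ a j i = 0

/-- A real square matrix `B` (meant to be indecomposable) is of finite type: `det B ≠ 0`, there is
`u > 0` with `B u > 0`, and `B v ≥ 0` implies `v > 0` or `v = 0`. Inequalities between vectors are
entrywise; `u > 0` means that all entries are strictly positive. -/
def IsFiniteTypeMatrix {κ : Type*} [Fintype κ] [DecidableEq κ] (B : Matrix κ κ ℝ) : Prop :=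
  B.det ≠ 0 ∧
  (∃ u : κ → ℝ, (∀ k, 0 < u k) ∧ ∀ k, 0 < B.mulVec u k) ∧
  ∀ v : κ → ℝ, (∀ k, 0 ≤ B.mulVec v k) → (∀ k, 0 < v k) ∨ v = 0

namespace GCM

variable {ι : Type*} (A : GCM ι)

/-- `A = D B` with `D` a diagonal matrix with positive rational entries and `B` a symmetric
rational matrix. -/
def IsSymmetrizable [Fintype ι] [DecidableEq ι] : Prop :=
  ∃ (ε : ι → ℚ) (B : Matrix ι ι ℚ), (∀ i, 0 < ε i) ∧ B.IsSymm ∧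
    A.a.map (fun z : ℤ => (z : ℚ)) = Matrix.diagonal ε * B

/-- The graph on `ι` in which distinct `i`, `j` are joined iff `a i j ≠ 0`. -/
def graph : SimpleGraph ι where
  Adj i j := i ≠ j ∧ A.a i j ≠ 0
  symm := ⟨fun i j h => ⟨h.1.symm, fun h0 => h.2 ((A.zero_iff i j).2 h0)⟩⟩
  loopless := ⟨fun _ h => h.1 rfl⟩

open Classical in
/-- `Θ` is special: every connected component of the submatrix of `A` on `Θ` is of non-finite
type (so `∅` is special). -/
def IsSpecial [Fintype ι] (Θ : Set ι) : Prop :=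
  ∀ c : (A.graph.induce Θ).ConnectedComponent,
    ¬ IsFiniteTypeMatrix (Matrix.of fun i j : c.supp => ((A.a i.1.1 j.1.1 : ℤ) : ℝ))

/-- `Θ^⊥ = {i | a i j = 0 for all j ∈ Θ}`. -/
def perp (Θ : Set ι) : Set ι := {i | ∀ j ∈ Θ, A.a i j = 0}

section WeylGroup

variable [DecidableEq ι]

/-- The exponent `m i j` (`i ≠ j`) as a function of `a i j * a j i`; `0` encodes that there is no
relation. -/
def exponent (p : ℤ) : ℕ :=
  if p = 0 then 2 else if p = 1 then 3 else if p = 2 then 4 else if p = 3 then 6 else 0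

/-- The Coxeter matrix of the Weyl group. -/
def coxeterMatrix : CoxeterMatrix ι where
  M := Matrix.of fun i j => if i = j then 1 else exponent (A.a i j * A.a j i)
  isSymm := by
    ext i j
    simp only [Matrix.transpose_apply, Matrix.of_apply, eq_comm (a := j) (b := i),
      mul_comm (A.a j i)]
  diagonal i := by simp
  off_diagonal i j h := by
    simp only [Matrix.of_apply, if_neg h, exponent]
    split_ifs <;> decide

/-- The Weyl group: the Coxeter group of `A.coxeterMatrix`. -/
abbrev WeylGroup : Type _ := A.coxeterMatrix.Group

/-- The length function of the Weyl group with respect to the simple reflections. -/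
noncomputable def length (w : A.WeylGroup) : ℕ := A.coxeterMatrix.toCoxeterSystem.length w

/-- The parabolic subgroup `W_J`, generated by the simple reflections `σ_i`, `i ∈ J`. -/
def parabolic (J : Set ι) : Subgroup A.WeylGroup :=
  Subgroup.closure (A.coxeterMatrix.simple '' J)

/-- `W^J`: the elements `w` of minimal length in their coset `w W_J`. -/
def minRepsLeft (J : Set ι) : Set A.WeylGroup :=
  {w | ∀ v ∈ A.parabolic J, A.length w ≤ A.length (w * v)}

/-- `^J W`: the elements `w` of minimal length in their coset `W_J w`. -/
def minRepsRight (J : Set ι) : Set A.WeylGroup :=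
  {w | ∀ v ∈ A.parabolic J, A.length w ≤ A.length (v * w)}

end WeylGroup

/-- A simply connected minimal free realization of `A`: the lattices are the free `ℤ`-module `H`
and its dual `P = Hom(H, ℤ)`. -/
structure Realization [Fintype ι] [DecidableEq ι] (H : Type*) [AddCommGroup H] [Module.Free ℤ H]
    [Module.Finite ℤ H] where
  /-- The simple coroots `h_i`. -/
  h : ι → H
  /-- The simple roots `α_i`. -/
  α : ι → (H →ₗ[ℤ] ℤ)
  finrank_eq : Module.finrank ℤ H =
    2 * Fintype.card ι - (A.a.map (fun z : ℤ => (z : ℚ))).rank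
  linearIndependent_h : LinearIndependent ℤ h
  linearIndependent_α : LinearIndependent ℤ α
  pairing : ∀ i j, α i (h j) = A.a j i
  /-- Fundamental dominant weights exist. -/
  exists_fundamental : ∃ Λ : ι → (H →ₗ[ℤ] ℤ), ∀ i j, Λ i (h j) = if i = j then 1 else 0

namespace Realization

variable {A} [Fintype ι] [DecidableEq ι] {H : Type*} [AddCommGroup H] [Module.Free ℤ H]
  [Module.Finite ℤ H] (D : A.Realization H)

/-- The simple reflection `σ_i h = h - α_i(h) h_i` of `H`. -/
def reflection (i : ι) : Module.End ℤ H :=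
  LinearMap.id - (D.α i).smulRight (D.h i)

theorem reflection_apply (i : ι) (x : H) : D.reflection i x = x - D.α i x • D.h i := by
  simp [reflection]

/-- Effect of `σ_i σ_j` on `x + s h_i + t h_j`. -/
theorem reflection_mul_reflection (i j : ι) (x : H) (s t : ℤ) :
    (D.reflection i * D.reflection j) (x + s • D.h i + t • D.h j) =
      x + (-s - D.α i x - A.a j i * (-t - D.α j x - A.a i j * s)) • D.h i
        + (-t - D.α j x - A.a i j * s) • D.h j := by
  simp only [Module.End.mul_apply, reflection_apply, map_add, map_sub, map_smul, D.pairing, A.diag]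
  module

theorem isLiftable_reflection : A.coxeterMatrix.IsLiftable D.reflection := by
  intro i j
  ext x
  have aux : ∀ P Q : ℤ, P = 0 → Q = 0 → x + P • D.h i + Q • D.h j = x := by
    rintro P Q rfl rfl
    simp
  have hx : x = x + (0 : ℤ) • D.h i + (0 : ℤ) • D.h j := by simp
  rw [Module.End.one_apply]
  by_cases hij : i = j
  · subst hij
    rw [A.coxeterMatrix.diagonal, pow_one]
    conv_lhs => rw [hx]
    rw [reflection_mul_reflection, A.diag]
    module
  · have hM : A.coxeterMatrix i j = exponent (A.a i j * A.a j i) := by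
      simp [coxeterMatrix, hij]
    have hz := A.zero_iff i j
    rw [hM]
    unfold exponent
    conv_lhs => rw [hx]
    split_ifs with h0 h1 h2 h3
    · have h1 : A.a i j = 0 := by
        rcases mul_eq_zero.1 h0 with h | h
        · exact h
        · exact hz.2 h
      have h2 : A.a j i = 0 := hz.1 h1
      simp only [pow_succ', pow_zero, mul_one, Module.End.mul_apply (D.reflection i * _),
        reflection_mul_reflection, h1, h2]
      apply aux <;> ring
    all_goals
      simp only [pow_succ', pow_zero, mul_one, Module.End.mul_apply (D.reflection i * _),
        reflection_mul_reflection, Module.End.one_apply]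
      clear hM hz hx
      generalize A.a i j = p at *
      generalize A.a j i = q at *
      generalize D.α i x = c at *
      generalize D.α j x = d at *
      apply aux <;> (clear aux; grind)

/-- The action of the Weyl group on `H`. -/
noncomputable def actH : A.WeylGroup →* Module.End ℤ H :=
  A.coxeterMatrix.toCoxeterSystem.lift ⟨D.reflection, D.isLiftable_reflection⟩

/-- The real vector space `h*_ℝ`, realized as `Hom(H, ℝ)`. -/
abbrev V (_ : A.Realization H) : Type _ := H →ₗ[ℤ] ℝ

/-- The contragredient action of the Weyl group on `h*_ℝ`: `(w λ)(h) = λ(w⁻¹ h)`. -/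
noncomputable def act (w : A.WeylGroup) : D.V →ₗ[ℝ] D.V where
  toFun l := l ∘ₗ D.actH w⁻¹
  map_add' _ _ := rfl
  map_smul' _ _ := rfl

theorem act_one (l : D.V) : D.act 1 l = l := by
  ext x
  simp [act]

theorem act_mul (w v : A.WeylGroup) (l : D.V) : D.act (w * v) l = D.act w (D.act v l) := by
  ext x
  simp [act]

/-- `σ_i λ = λ - λ(h_i) α_i`. -/
theorem act_simple (i : ι) (l : D.V) (x : H) :
    D.act (A.coxeterMatrix.simple i) l x = l x - l (D.h i) * D.α i x := by
  have h1 : (A.coxeterMatrix.simple i)⁻¹ = A.coxeterMatrix.toCoxeterSystem.simple i := by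
    rw [← CoxeterMatrix.toCoxeterSystem_simple]
    exact A.coxeterMatrix.toCoxeterSystem.inv_simple i
  simp only [act, actH, LinearMap.coe_mk, AddHom.coe_mk, LinearMap.comp_apply, h1,
    CoxeterSystem.lift_apply_simple, reflection_apply, map_sub, map_smul, zsmul_eq_mul]
  ring

theorem act_inv_act (w : A.WeylGroup) (l : D.V) : D.act w⁻¹ (D.act w l) = l := by
  rw [← act_mul, inv_mul_cancel, act_one]

theorem act_act_inv (w : A.WeylGroup) (l : D.V) : D.act w (D.act w⁻¹ l) = l := by
  rw [← act_mul, mul_inv_cancel, act_one]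

/-- The closed fundamental chamber `C̄`. -/
def chamber : Set D.V := {l | ∀ i, 0 ≤ l (D.h i)}

/-- The Tits cone `X = W C̄`. -/
def titsCone : Set D.V := {l | ∃ w : A.WeylGroup, ∃ m ∈ D.chamber, l = D.act w m}

theorem act_mem_titsCone (w : A.WeylGroup) {l : D.V} (hl : l ∈ D.titsCone) :
    D.act w l ∈ D.titsCone := by
  obtain ⟨v, m, hm, rfl⟩ := hl
  exact ⟨w * v, m, hm, (D.act_mul w v m).symm⟩

theorem smul_mem_titsCone {c : ℝ} (hc : 0 ≤ c) {l : D.V} (hl : l ∈ D.titsCone) :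
    c • l ∈ D.titsCone := by
  obtain ⟨v, m, hm, rfl⟩ := hl
  exact ⟨v, c • m, fun i => mul_nonneg hc (hm i), by simp⟩

/-- A face of the Tits cone `X`: a non-empty convex subset `F ⊆ X` such that `x, y ∈ X` and
`]x, y[ ∩ F ≠ ∅` imply `x, y ∈ F`. -/
def IsFace (F : Set D.V) : Prop :=
  F.Nonempty ∧ Convex ℝ F ∧ IsExtreme ℝ D.titsCone F

theorem IsFace.zero_mem {F : Set D.V} (hF : D.IsFace F) : (0 : D.V) ∈ F := by
  obtain ⟨⟨x, hx⟩, -, hE⟩ := hF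
  have hxX := hE.subset hx
  have h0 : (0 : D.V) ∈ D.titsCone := by simpa using D.smul_mem_titsCone le_rfl hxX
  have h2 := D.smul_mem_titsCone (c := 2) (by norm_num) hxX
  exact hE.left_mem_of_mem_openSegment h0 h2 hx
    ⟨1 / 2, 1 / 2, by norm_num, by norm_num, by norm_num, by rw [smul_smul]; norm_num⟩

theorem IsFace.inter {F G : Set D.V} (hF : D.IsFace F) (hG : D.IsFace G) : D.IsFace (F ∩ G) :=
  ⟨⟨0, hF.zero_mem, hG.zero_mem⟩, hF.2.1.inter hG.2.1, hF.2.2.inter hG.2.2⟩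

theorem IsFace.image {F : Set D.V} (hF : D.IsFace F) (w : A.WeylGroup) :
    D.IsFace (D.act w '' F) := by
  refine ⟨hF.1.image _, hF.2.1.linear_image _, ?_, ?_⟩
  · rintro _ ⟨l, hl, rfl⟩
    exact D.act_mem_titsCone w (hF.2.2.subset hl)
  · rintro x hx y hy _ ⟨z, hz, rfl⟩ ⟨a, b, ha, hb, hab, h⟩
    refine ⟨D.act w⁻¹ x, ?_, D.act_act_inv w x⟩
    refine hF.2.2.left_mem_of_mem_openSegment (D.act_mem_titsCone _ hx)
      (D.act_mem_titsCone w⁻¹ hy) hz ⟨a, b, ha, hb, hab, ?_⟩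
    rw [← map_smul, ← map_smul, ← map_add, h, act_inv_act]

/-- The set of faces of the Tits cone. -/
abbrev Face : Type _ := {F : Set D.V // D.IsFace F}

/-- The set `R(Θ)` of all `λ ∈ X` with `λ(h_i) = 0` for all `i ∈ Θ`. -/
def faceSet (Θ : Set ι) : Set D.V := {l | l ∈ D.titsCone ∧ ∀ i ∈ Θ, l (D.h i) = 0}

/-- The underlying set of the semidirect product of the monoid of faces (under intersection) with
the Weyl group. -/
@[ext]
structure FaceSemidirect where
  face : D.Face
  elt : A.WeylGroup

/-- `(R, σ) (S, τ) = (R ∩ σ S, σ τ)`. -/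
noncomputable instance : Mul D.FaceSemidirect where
  mul p q := ⟨⟨p.face.1 ∩ D.act p.elt '' q.face.1, p.face.2.inter D (q.face.2.image D p.elt)⟩,
    p.elt * q.elt⟩

theorem FaceSemidirect.mul_face (p q : D.FaceSemidirect) :
    (p * q).face.1 = p.face.1 ∩ D.act p.elt '' q.face.1 := rfl

theorem FaceSemidirect.mul_elt (p q : D.FaceSemidirect) : (p * q).elt = p.elt * q.elt := rfl

theorem act_injective (w : A.WeylGroup) : Function.Injective (D.act w) :=
  Function.LeftInverse.injective (D.act_inv_act w)

noncomputable instance : Semigroup D.FaceSemidirect where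
  mul_assoc p q r := by
    refine FaceSemidirect.ext (Subtype.ext ?_) ?_
    · simp only [FaceSemidirect.mul_face, FaceSemidirect.mul_elt]
      rw [Set.image_inter (D.act_injective _), Set.inter_assoc, Set.image_image]
      simp only [act_mul]
    · simp only [FaceSemidirect.mul_elt, mul_assoc]

/-- `Z_W(F)`: the pointwise stabilizer of `F` in the Weyl group. -/
def pointwiseStabilizer (F : Set D.V) : Set A.WeylGroup := {w | ∀ l ∈ F, D.act w l = l}

/-- The congruence `(R, σ) ∼ (R', σ')` iff `R = R'` and `σ' σ⁻¹ ∈ Z_W(R)`. -/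
noncomputable def weylCon : Con D.FaceSemidirect where
  r p q := p.face = q.face ∧ q.elt * p.elt⁻¹ ∈ D.pointwiseStabilizer p.face.1
  iseqv := by
    refine ⟨fun p => ⟨rfl, fun l _ => ?_⟩, ?_, ?_⟩
    · rw [mul_inv_cancel, act_one]
    · rintro p q ⟨h1, h2⟩
      refine ⟨h1.symm, fun l hl => ?_⟩
      have h3 := h2 l (h1 ▸ hl)
      have h4 : p.elt * q.elt⁻¹ = (q.elt * p.elt⁻¹)⁻¹ := by group
      rw [h4]
      nth_rewrite 1 [← h3]
      rw [act_inv_act]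
    · rintro p q r ⟨h1, h2⟩ ⟨h3, h4⟩
      refine ⟨h1.trans h3, fun l hl => ?_⟩
      have h5 : r.elt * p.elt⁻¹ = (r.elt * q.elt⁻¹) * (q.elt * p.elt⁻¹) := by group
      rw [h5, act_mul, h2 l hl, h4 l (h1 ▸ hl)]
  mul' := by
    rintro p q r s ⟨h1, h2⟩ ⟨h3, h4⟩
    have key : ∀ l ∈ p.face.1, D.act q.elt⁻¹ l = D.act p.elt⁻¹ l := by
      intro l hl
      nth_rewrite 1 [← h2 l hl]
      rw [act_mul, act_inv_act]
    refine ⟨Subtype.ext ?_, ?_⟩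
    · rw [FaceSemidirect.mul_face, FaceSemidirect.mul_face, ← h1, ← h3]
      ext l
      refine and_congr_right fun hl => ⟨?_, ?_⟩
      · rintro ⟨m, hm, rfl⟩
        refine ⟨m, hm, ?_⟩
        have := key _ hl
        rw [act_inv_act] at this
        nth_rewrite 1 [← this]
        rw [act_act_inv]
      · rintro ⟨m, hm, rfl⟩
        refine ⟨m, hm, ?_⟩
        have := key _ hl
        rw [act_inv_act] at this
        nth_rewrite 1 [this]
        rw [act_act_inv]
    · rintro l ⟨hl, m, hm, rfl⟩
      have h5 : (q * s).elt * (p * r).elt⁻¹ =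
          q.elt * ((s.elt * r.elt⁻¹) * p.elt⁻¹) := by
        simp only [FaceSemidirect.mul_elt]
        group
      have := key _ hl
      rw [act_inv_act] at this
      rw [h5, act_mul, act_mul, act_inv_act, h4 m hm]
      nth_rewrite 1 [← this]
      rw [act_act_inv]

/-- The Weyl monoid `Ŵ`: the semidirect product factored by the congruence `weylCon`. -/
def WeylMonoid : Type _ := D.weylCon.Quotient

noncomputable instance : Semigroup D.WeylMonoid :=
  inferInstanceAs (Semigroup D.weylCon.Quotient)

/-- The class `e(R) σ` of `(R, σ)` in the Weyl monoid. -/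
noncomputable def WeylMonoid.mk (F : D.Face) (w : A.WeylGroup) : D.WeylMonoid :=
  ((⟨F, w⟩ : D.FaceSemidirect) : D.weylCon.Quotient)

/-- The element `e(R) = e(R) 1` of the Weyl monoid. -/
noncomputable def e (F : D.Face) : D.WeylMonoid := WeylMonoid.mk D F 1

/-- The Tits cone `X` is a face of itself (that is, `X` is convex) by a theorem, which `hX` records.
The Weyl group element `w` is identified with the element `e(X) w` of the Weyl monoid. -/
noncomputable def ofWeyl (hX : D.IsFace D.titsCone) (w : A.WeylGroup) : D.WeylMonoid :=
  WeylMonoid.mk D ⟨D.titsCone, hX⟩ w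

theorem mk_mul_mk (F G : D.Face) (w v : A.WeylGroup) :
    WeylMonoid.mk D F w * WeylMonoid.mk D G v =
      WeylMonoid.mk D ⟨F.1 ∩ D.act w '' G.1, F.2.inter D (G.2.image D w)⟩ (w * v) := rfl

theorem act_image_titsCone (w : A.WeylGroup) : D.act w '' D.titsCone = D.titsCone := by
  refine Set.Subset.antisymm ?_ fun l hl =>
    ⟨D.act w⁻¹ l, D.act_mem_titsCone _ hl, D.act_act_inv w l⟩
  rintro _ ⟨l, hl, rfl⟩
  exact D.act_mem_titsCone w hl

/-- The Weyl monoid is a monoid with identity `e(X)`. -/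
noncomputable abbrev monoid (hX : D.IsFace D.titsCone) : Monoid D.WeylMonoid where
  one := D.ofWeyl hX 1
  one_mul x := by
    obtain ⟨⟨F, w⟩, rfl⟩ := Quotient.exists_rep x
    change WeylMonoid.mk D ⟨D.titsCone, hX⟩ 1 * WeylMonoid.mk D F w = WeylMonoid.mk D F w
    rw [mk_mul_mk, one_mul]
    congr 1
    refine Subtype.ext ?_
    have : D.act 1 '' F.1 = F.1 := by
      simp [act_one]
    simp only [this]
    exact Set.inter_eq_right.2 F.2.2.2.subset
  mul_one x := by
    obtain ⟨⟨F, w⟩, rfl⟩ := Quotient.exists_rep x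
    change WeylMonoid.mk D F w * WeylMonoid.mk D ⟨D.titsCone, hX⟩ 1 = WeylMonoid.mk D F w
    rw [mk_mul_mk, mul_one]
    congr 1
    refine Subtype.ext ?_
    simp only [act_image_titsCone]
    exact Set.inter_eq_left.2 F.2.2.2.subset

end Realization

end GCM

set_option linter.unusedSectionVars false

/-! Questions about $X$, its faces and the parabolic subgroups are transferred to $\mathbb R^I$, the
space of coefficients of coroots: $\mathcal W$ acts there by `rho`, and $\lambda$ pairs with it by
`eval`. The base is `rho_coroot_nonneg`, the positivity theorem for Coxeter groups: $w$ maps $h_i$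
to a non-negative vector exactly when $i$ is not a right descent of $w$. It yields the theory of
minimal coset representatives, and the description of $X$ as the set of $\lambda$ that are negative
on only finitely many positive real coroots, which is visibly convex.

Special sets turn out to be the supports of vectors $u\ge0$ with $\alpha_j(u)\le0$ for all $j$
(`isSpecial_iff`). Such a $u$ is the least element of its $\mathcal W$-orbit
(`le_rho_of_antidominant`), so it is non-negative on $X$, and $R(\Theta)$ is the face where it
vanishes. Conversely, the zero set of a chamber point $m$ splits orthogonally into a special
$\Theta$ and a set with only finitely many positive coroots. The finite part does not obstruct
prolonging segments through $m$, so $m$ is relatively interior to $R(\Theta)$. It follows that every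
face is some $wR(\Theta)$.

The rest is coset combinatorics. The pointwise stabilizer of $R(\Theta)$ is $\mathcal W_\Theta$, and
$gR(\Theta')=R(\Theta)$ forces $\Theta'=\Theta$ and $g\in\mathcal W_{\Theta\cup\Theta^\bot}=\mathcal
W_\Theta\mathcal W_{\Theta^\bot}$, with commuting factors. So $w_1e(R(\Theta))w_2$ determines
$\Theta$, and determines $(w_1,w_2)$ up to moving $\mathcal W_{\Theta^\bot}$ across the idempotent
and absorbing $\mathcal W_\Theta$ into it (`ofWeyl_mul_e_mul_ofWeyl_eq_iff`). Keeping the $\mathcal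
W_{\Theta^\bot}$-part on the left, on the right or as a separate factor gives I, II and III. -/

namespace GCM

/-! ### The Weyl group on coroot space and the positivity theorem. -/

section CorootSpace

variable {ι : Type*} [Fintype ι] [DecidableEq ι] (A : GCM ι)

/-- The simple root `α_i` as a linear form on the real space `ι → ℝ` of coroot coefficients. -/
noncomputable def simpleRoot (i : ι) : (ι → ℝ) →ₗ[ℝ] ℝ :=
  ∑ j, (A.a j i : ℝ) • LinearMap.proj j

theorem simpleRoot_apply (i : ι) (c : ι → ℝ) : A.simpleRoot i c = ∑ j, A.a j i * c j := by
  simp [simpleRoot]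

/-- The simple coroot `h_i` in coefficient space. -/
def coroot (i : ι) : ι → ℝ := Pi.single i 1

theorem coroot_self (i : ι) : coroot i i = 1 := by simp [coroot]

theorem coroot_of_ne {i j : ι} (h : j ≠ i) : coroot i j = 0 := by simp [coroot, h]

theorem coroot_nonneg (i : ι) : 0 ≤ coroot i := by
  simp [coroot]

theorem coroot_ne_zero (i : ι) : coroot i ≠ 0 := fun h => by
  simpa [coroot_self] using congrFun h i

theorem eq_sum_smul_coroot (c : ι → ℝ) : c = ∑ i, c i • coroot i := by
  ext j
  simp [coroot, Pi.single_apply]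

theorem simpleRoot_coroot (i j : ι) : A.simpleRoot i (coroot j) = A.a j i := by
  simp [simpleRoot_apply, coroot, Pi.single_apply]

/-- The simple reflection on coefficient space. -/
noncomputable def coreflection (i : ι) : Module.End ℝ (ι → ℝ) :=
  LinearMap.id - (A.simpleRoot i).smulRight (coroot i)

theorem coreflection_apply (i : ι) (c : ι → ℝ) :
    A.coreflection i c = c - A.simpleRoot i c • coroot i := by
  simp [coreflection]

/-- With this formula the relation $(\sigma_i\sigma_j)^{m_{ij}}=1$ becomes the vanishing of two
polynomials in $a_{ij}$, $a_{ji}$, $\alpha_i(x)$, $\alpha_j(x)$. -/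
theorem coreflection_mul_coreflection (i j : ι) (x : ι → ℝ) (s t : ℝ) :
    (A.coreflection i * A.coreflection j) (x + s • coroot i + t • coroot j) =
      x + (-s - A.simpleRoot i x - A.a j i * (-t - A.simpleRoot j x - A.a i j * s)) • coroot i
        + (-t - A.simpleRoot j x - A.a i j * s) • coroot j := by
  simp only [Module.End.mul_apply, coreflection_apply, map_add, map_sub, map_smul,
    simpleRoot_coroot, A.diag, Int.cast_ofNat]
  module

theorem isLiftable_coreflection : A.coxeterMatrix.IsLiftable A.coreflection := by
  intro i j
  refine LinearMap.ext fun x => ?_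
  have aux : ∀ P Q : ℝ, P = 0 → Q = 0 → x + P • coroot i + Q • coroot j = x := by
    rintro P Q rfl rfl
    simp
  have hx : x = x + (0 : ℝ) • coroot i + (0 : ℝ) • coroot j := by simp
  rw [Module.End.one_apply]
  by_cases hij : i = j
  · subst hij
    rw [A.coxeterMatrix.diagonal, pow_one]
    conv_lhs => rw [hx]
    rw [coreflection_mul_coreflection, A.diag]
    push_cast
    module
  · have hM : A.coxeterMatrix i j = exponent (A.a i j * A.a j i) := by
      simp [coxeterMatrix, hij]
    have hz := A.zero_iff i j
    rw [hM]
    unfold exponent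
    conv_lhs => rw [hx]
    split_ifs with h0 h1 h2 h3
    -- The last case has exponent $0$, where the power is trivially the identity.
    rotate_right
    · simp
    · have h1 : A.a i j = 0 := by
        rcases mul_eq_zero.1 h0 with h | h
        · exact h
        · exact hz.2 h
      have h2 : A.a j i = 0 := hz.1 h1
      simp only [pow_succ', pow_zero, mul_one, Module.End.mul_apply (A.coreflection i * _),
        coreflection_mul_coreflection, h1, h2, Int.cast_zero]
      apply aux <;> ring
    all_goals
      simp only [pow_succ', pow_zero, mul_one, Module.End.mul_apply (A.coreflection i * _),
        coreflection_mul_coreflection]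
      have h := congrArg (fun z : ℤ => (z : ℝ)) (by assumption : A.a i j * A.a j i = _)
      clear hM hz hx
      push_cast at h
      generalize (A.a i j : ℝ) = p at *
      generalize (A.a j i : ℝ) = q at *
      generalize A.simpleRoot i x = c at *
      generalize A.simpleRoot j x = d at *
      apply aux <;> (clear aux; grind)

/-- The Coxeter system of the Weyl group. -/
noncomputable abbrev cs : CoxeterSystem A.coxeterMatrix A.WeylGroup :=
  A.coxeterMatrix.toCoxeterSystem

/-- The action of the Weyl group on coefficient space. -/
noncomputable def rho : A.WeylGroup →* Module.End ℝ (ι → ℝ) :=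
  A.cs.lift ⟨A.coreflection, A.isLiftable_coreflection⟩

theorem rho_simple (i : ι) (c : ι → ℝ) :
    A.rho (A.cs.simple i) c = c - A.simpleRoot i c • coroot i := by
  rw [rho, CoxeterSystem.lift_apply_simple, coreflection_apply]

theorem rho_mul (w v : A.WeylGroup) (c : ι → ℝ) : A.rho (w * v) c = A.rho w (A.rho v c) := by
  rw [map_mul, Module.End.mul_apply]

theorem rho_one (c : ι → ℝ) : A.rho 1 c = c := by
  rw [map_one, Module.End.one_apply]

theorem rho_inv_rho (w : A.WeylGroup) (c : ι → ℝ) : A.rho w⁻¹ (A.rho w c) = c := by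
  rw [← rho_mul, inv_mul_cancel, rho_one]

theorem rho_injective (w : A.WeylGroup) : Function.Injective (A.rho w) :=
  Function.LeftInverse.injective (A.rho_inv_rho w)

theorem rho_simple_coroot (i : ι) : A.rho (A.cs.simple i) (coroot i) = -coroot i := by
  rw [rho_simple, simpleRoot_coroot, A.diag]
  push_cast
  module

theorem rho_eq_sum (w : A.WeylGroup) (c : ι → ℝ) :
    A.rho w c = ∑ i, c i • A.rho w (coroot i) := by
  conv_lhs => rw [eq_sum_smul_coroot c]
  simp

theorem rho_nonneg {w : A.WeylGroup} {c : ι → ℝ} (hc : 0 ≤ c)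
    (h : ∀ i, c i ≠ 0 → 0 ≤ A.rho w (coroot i)) : 0 ≤ A.rho w c := by
  rw [rho_eq_sum]
  refine Finset.sum_nonneg fun i _ => ?_
  by_cases hi : c i = 0
  · simp [hi]
  · exact smul_nonneg (hc i) (h i hi)

/-- The coefficients of `h_i` and `h_j` in the image of `h_i` under the alternating word of
length `k` ending in `j`, where `p = -a i j`, `q = -a j i`. -/
noncomputable def dihedralCoeff (p q : ℝ) : ℕ → ℝ × ℝ
  | 0 => (1, 0)
  | k + 1 =>
    if Even k then ((dihedralCoeff p q k).1, p * (dihedralCoeff p q k).1 - (dihedralCoeff p q k).2)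
    else (q * (dihedralCoeff p q k).2 - (dihedralCoeff p q k).1, (dihedralCoeff p q k).2)

/-- The parity-dependent inequalities make the induction work: $qy\le2x$ and $pq\ge4$ give $2y\le
px$, so the new coefficient $px-y$ is non-negative and satisfies the inequality for the next parity.
-/
theorem dihedralCoeff_nonneg_of_four_le {p q : ℝ} (hp : 0 ≤ p) (hq : 0 ≤ q) (h : 4 ≤ p * q)
    (k : ℕ) : 0 ≤ (dihedralCoeff p q k).1 ∧ 0 ≤ (dihedralCoeff p q k).2 ∧
      (Even k → q * (dihedralCoeff p q k).2 ≤ 2 * (dihedralCoeff p q k).1) ∧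
      (¬ Even k → p * (dihedralCoeff p q k).1 ≤ 2 * (dihedralCoeff p q k).2) := by
  induction k with
  | zero => simp [dihedralCoeff]
  | succ k ih =>
    rw [dihedralCoeff]
    generalize (dihedralCoeff p q k).1 = x at *
    generalize (dihedralCoeff p q k).2 = y at *
    obtain ⟨hx, hy, h1, h2⟩ := ih
    by_cases hk : Even k
    · have h3 := h1 hk
      have h4 : 2 * y ≤ p * x := by
        nlinarith [mul_le_mul_of_nonneg_left h3 hp, mul_le_mul_of_nonneg_right h hy]
      simp only [hk, if_true, Nat.even_add_one, not_true, IsEmpty.forall_iff, not_false_iff,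
        forall_true_left, true_and]
      exact ⟨hx, by linarith, by linarith⟩
    · have h3 := h2 hk
      have h4 : 2 * x ≤ q * y := by
        nlinarith [mul_le_mul_of_nonneg_left h3 hq, mul_le_mul_of_nonneg_right h hx]
      simp only [hk, if_false, Nat.even_add_one, not_true, IsEmpty.forall_iff, not_false_iff,
        forall_true_left, and_true]
      exact ⟨by linarith, hy, by linarith⟩

/-- The finite dihedral cases, by explicit values. The bounds on $k$ are $m_{ij}=2,3,4,6$; the
alternative $k<2$ serves $pq=0$. -/
theorem dihedralCoeff_nonneg_of_lt {p q : ℝ} (hp : 0 ≤ p) (k : ℕ)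
    (h : k < 2 ∨ (p * q = 1 ∧ k < 3) ∨ (p * q = 2 ∧ k < 4) ∨ (p * q = 3 ∧ k < 6)) :
    0 ≤ (dihedralCoeff p q k).1 ∧ 0 ≤ (dihedralCoeff p q k).2 := by
  have e3 : ¬ Even 3 := by decide
  have e2 : Even 2 := by decide
  have e4 : Even 4 := by decide
  have hk : k < 6 := by omega
  interval_cases k
  · simp [dihedralCoeff]
  · simp [dihedralCoeff, hp]
  · have h1 : 1 ≤ p * q := by
      rcases h with h | h | h | h
      · omega
      all_goals linarith [h.1]
    simp [dihedralCoeff, hp, mul_comm q p, h1]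
  · have h1 : 2 ≤ p * q := by
      rcases h with h | h | h | h
      · omega
      · omega
      all_goals linarith [h.1]
    have : 0 ≤ p * (p * q - 2) := mul_nonneg hp (by linarith)
    simp only [dihedralCoeff, e2, Nat.not_even_one, Even.zero, if_true, if_false]
    constructor <;> linarith
  · have h1 : p * q = 3 := by
      rcases h with h | h | h | h <;> first | omega | exact h.1
    have : q * (p * (p * q - 2)) = 3 := by rw [h1]; linarith
    have h5 : p * (p * q) = p * 3 := by rw [h1]
    simp only [dihedralCoeff, e2, e3, Nat.not_even_one, Even.zero, if_true, if_false]
    constructor <;> linarith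
  · have h1 : p * q = 3 := by
      rcases h with h | h | h | h <;> first | omega | exact h.1
    have h2 : q * (p * (p * q - 2)) = 3 := by rw [h1]; linarith
    have h3 : p * (q * (p * (p * q - 2))) = p * 3 := by rw [h2]
    have h5 : p * (p * q) = p * 3 := by rw [h1]
    simp only [dihedralCoeff, e2, e3, e4, Nat.not_even_one, Even.zero, if_true, if_false]
    constructor <;> linarith

theorem rho_alternatingWord (i j : ι) (k : ℕ) :
    A.rho (A.cs.wordProd (CoxeterSystem.alternatingWord i j k)) (coroot i) =
      (dihedralCoeff (-A.a i j) (-A.a j i) k).1 • coroot i +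
        (dihedralCoeff (-A.a i j) (-A.a j i) k).2 • coroot j := by
  induction k with
  | zero => simp [dihedralCoeff, CoxeterSystem.alternatingWord]
  | succ k ih =>
    rw [CoxeterSystem.alternatingWord_succ', CoxeterSystem.wordProd_cons, rho_mul, ih, rho_simple,
      dihedralCoeff]
    split_ifs
    all_goals
      simp only [map_add, map_smul, simpleRoot_coroot, A.diag, smul_eq_mul]
      push_cast
      module

theorem rho_alternatingWord_nonneg {i j : ι} (hij : i ≠ j) (k : ℕ)
    (hk : A.coxeterMatrix i j ≠ 0 → k < A.coxeterMatrix i j) :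
    ∃ x y : ℝ, 0 ≤ x ∧ 0 ≤ y ∧
      A.rho (A.cs.wordProd (CoxeterSystem.alternatingWord i j k)) (coroot i) =
        x • coroot i + y • coroot j := by
  refine ⟨_, _, ?_, ?_, A.rho_alternatingWord i j k⟩
  all_goals
    have hp : (0 : ℝ) ≤ -A.a i j := by exact_mod_cast neg_nonneg.2 (A.nonpos i j hij)
    have hq : (0 : ℝ) ≤ -A.a j i := by exact_mod_cast neg_nonneg.2 (A.nonpos j i hij.symm)
    have hM : A.coxeterMatrix i j = exponent (A.a i j * A.a j i) := by
      simp [coxeterMatrix, hij]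
    rw [hM] at hk
    have hpq : 0 ≤ A.a i j * A.a j i :=
      mul_nonneg_of_nonpos_of_nonpos (A.nonpos i j hij) (A.nonpos j i hij.symm)
    have hc : (-A.a i j : ℝ) * (-A.a j i) = ((A.a i j * A.a j i : ℤ) : ℝ) := by push_cast; ring
    by_cases h4 : 4 ≤ A.a i j * A.a j i
    · have := dihedralCoeff_nonneg_of_four_le hp hq (by rw [hc]; exact_mod_cast h4) k
      first | exact this.1 | exact this.2.1
    · have := dihedralCoeff_nonneg_of_lt (q := -A.a j i) hp k (by
        rw [hc]
        generalize A.a i j * A.a j i = t at *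
        interval_cases t
        · left; simpa [exponent] using hk
        · right; left; simpa [exponent] using hk
        · right; right; left; simpa [exponent] using hk
        · right; right; right; simpa [exponent] using hk)
      first | exact this.1 | exact this.2

/-- Induction on length. With $j$ a right descent of $w$, split off a maximal alternating word in
$i,j$ from the right: $w=vg$ with lengths adding and neither $i$ nor $j$ a right descent of $v$. The
rank two computation writes $gh_i$ as a non-negative combination of $h_i,h_j$, and the shorter $v$
keeps both non-negative. -/
theorem rho_coroot_nonneg (w : A.WeylGroup) (i : ι) (h : ¬ A.cs.IsRightDescent w i) :
    0 ≤ A.rho w (coroot i) := by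
  induction hn : A.cs.length w using Nat.strong_induction_on generalizing w i with
  | _ n IH =>
  subst hn
  by_cases hw : w = 1
  · rw [hw, rho_one]
    exact coroot_nonneg i
  obtain ⟨j, hj⟩ := A.cs.exists_rightDescent_of_ne_one hw
  have hij : i ≠ j := by rintro rfl; exact h hj
  set g : ℕ → A.WeylGroup := fun k => A.cs.wordProd (CoxeterSystem.alternatingWord i j k) with hg
  have hg_succ : ∀ k, w * (g (k + 1))⁻¹ = w * (g k)⁻¹ * A.cs.simple (if Even k then j else i) := by
    intro k
    simp only [hg]
    rw [CoxeterSystem.alternatingWord_succ', CoxeterSystem.wordProd_cons, mul_inv_rev,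
      CoxeterSystem.inv_simple, mul_assoc]
  have hg_len : ∀ k, A.cs.length (g k) ≤ k := fun k =>
    (A.cs.length_wordProd_le _).trans (by simp)
  have hle : ∀ k, A.cs.length w ≤ A.cs.length (w * (g k)⁻¹) + k := by
    intro k
    have := A.cs.length_mul_le (w * (g k)⁻¹) (g k)
    rw [inv_mul_cancel_right] at this
    have := hg_len k
    omega
  -- `S k`: stripping $k$ alternating letters lowers the length by exactly $k$. The greatest such
  -- $k$ is at most the length of $w$, and maximality excludes one further letter.
  let S : ℕ → Prop := fun k => A.cs.length (w * (g k)⁻¹) + k = A.cs.length w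
  have hS : ∀ k, S k ↔ A.cs.length (w * (g k)⁻¹) + k = A.cs.length w := fun _ => Iff.rfl
  classical
  have hS1 : S 1 := by
    have := A.cs.isRightDescent_iff.1 hj
    rw [hS]
    simpa only [hg, CoxeterSystem.alternatingWord, List.concat_nil, CoxeterSystem.wordProd_singleton,
      CoxeterSystem.inv_simple] using this
  have hwpos : 1 ≤ A.cs.length w := by
    have : A.cs.length w ≠ 0 := fun h0 => hw (A.cs.length_eq_zero_iff.1 h0)
    omega
  obtain ⟨k, hk1, hSk, hSk'⟩ : ∃ k, S (k + 1) ∧ (A.cs.length (w * (g (k + 1))⁻¹) < A.cs.length w) ∧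
      ¬ S (k + 2) := by
    have h1 := Nat.findGreatest_spec (P := S) hwpos hS1
    have h2 : 1 ≤ Nat.findGreatest S (A.cs.length w) := Nat.le_findGreatest hwpos hS1
    refine ⟨Nat.findGreatest S (A.cs.length w) - 1, ?_, ?_, ?_⟩
    · rwa [Nat.sub_add_cancel h2]
    · rw [Nat.sub_add_cancel h2]
      rw [hS] at h1
      omega
    · have h3 : Nat.findGreatest S (A.cs.length w) - 1 + 2 =
        Nat.findGreatest S (A.cs.length w) + 1 := by omega
      rw [h3]
      intro h4
      have h5 : Nat.findGreatest S (A.cs.length w) + 1 ≤ A.cs.length w := by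
        rw [hS] at h4
        omega
      have := Nat.le_findGreatest h5 h4
      omega
  set v := w * (g (k + 1))⁻¹ with hv
  have hwv : w = v * g (k + 1) := by rw [hv, inv_mul_cancel_right]
  have hlen : A.cs.length v + (k + 1) = A.cs.length w := hk1
  have hnext : ¬ A.cs.IsRightDescent v (if Even k then i else j) := by
    intro hd
    apply hSk'
    have := A.cs.isRightDescent_iff.1 hd
    rw [hS]
    rw [hg_succ, ← hv]
    have hpar : (if Even (k + 1) then j else i) = if Even k then i else j := by
      by_cases hk : Even k <;> simp [hk, Nat.even_add_one]
    rw [hpar]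
    omega
  have hprev : ¬ A.cs.IsRightDescent v (if Even k then j else i) := by
    intro hd
    have h1 := A.cs.isRightDescent_iff.1 hd
    have h2 : v * A.cs.simple (if Even k then j else i) = w * (g k)⁻¹ := by
      rw [hv, hg_succ, CoxeterSystem.simple_mul_simple_cancel_right]
    rw [h2] at h1
    have := hle k
    omega
  have hi : 0 ≤ A.rho v (coroot i) := by
    refine IH _ hSk v i ?_ rfl
    by_cases hk : Even k
    · simpa [hk] using hnext
    · simpa [hk] using hprev
  have hj : 0 ≤ A.rho v (coroot j) := by
    refine IH _ hSk v j ?_ rfl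
    by_cases hk : Even k
    · simpa [hk] using hprev
    · simpa [hk] using hnext
  obtain ⟨x, y, hx, hy, hxy⟩ := A.rho_alternatingWord_nonneg hij (k + 1) (by
    -- The stripped word is reduced, so it has at most $m_{ij}$ letters. If it had exactly $m_{ij}$,
    -- then $g\sigma_i$ would equal an alternating word with $m_{ij}-1$ letters, making $i$ a right
    -- descent of $w$.
    intro hM
    by_contra hlt
    have hred : A.cs.IsReduced (CoxeterSystem.alternatingWord i j (k + 1)) := by
      have h1 := A.cs.length_mul_le v (g (k + 1))
      rw [← hwv] at h1
      have h2 := hg_len (k + 1)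
      rw [CoxeterSystem.IsReduced, CoxeterSystem.length_alternatingWord]
      change A.cs.length (g (k + 1)) = _
      omega
    have hkM : k + 1 = A.coxeterMatrix i j := by
      by_contra hne
      exact A.cs.not_isReduced_alternatingWord i j hM (by omega) hred
    apply h
    have h1 : w * A.cs.simple i =
        v * A.cs.wordProd (CoxeterSystem.alternatingWord i j (A.coxeterMatrix i j * 2 - (k + 2))) := by
      have h2 := A.cs.prod_alternatingWord_eq_prod_alternatingWord_sub j i (k + 2)
        (by rw [A.coxeterMatrix.symmetric j i]; omega)
      rw [CoxeterSystem.alternatingWord_succ, CoxeterSystem.wordProd_concat,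
        A.coxeterMatrix.symmetric j i] at h2
      rw [← h2, hwv, mul_assoc]
    rw [CoxeterSystem.IsRightDescent, h1]
    have h3 := A.cs.length_mul_le v
      (A.cs.wordProd (CoxeterSystem.alternatingWord i j (A.coxeterMatrix i j * 2 - (k + 2))))
    have h4 := A.cs.length_wordProd_le
      (CoxeterSystem.alternatingWord i j (A.coxeterMatrix i j * 2 - (k + 2)))
    rw [CoxeterSystem.length_alternatingWord] at h4
    omega)
  rw [hwv, rho_mul, hxy, map_add, map_smul, map_smul]
  exact add_nonneg (smul_nonneg hx hi) (smul_nonneg hy hj)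

end CorootSpace

end GCM

namespace GCM

/-! ### Parabolic subgroups, minimal coset representatives, antidominant vectors. -/

section Parabolic

variable {ι : Type*} [Fintype ι] [DecidableEq ι] (A : GCM ι)

theorem rho_coroot_nonpos (w : A.WeylGroup) (i : ι) (h : A.cs.IsRightDescent w i) :
    A.rho w (coroot i) ≤ 0 := by
  have h1 := A.rho_coroot_nonneg (w * A.cs.simple i) i
    (A.cs.isRightDescent_iff_not_isRightDescent_mul.1 h)
  rwa [rho_mul, rho_simple_coroot, map_neg, Left.nonneg_neg_iff] at h1

theorem rho_coroot_ne_zero (w : A.WeylGroup) (i : ι) : A.rho w (coroot i) ≠ 0 := fun h =>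
  coroot_ne_zero i (A.rho_injective w (h.trans (map_zero _).symm))

theorem rho_coroot_nonneg_iff (w : A.WeylGroup) (i : ι) :
    0 ≤ A.rho w (coroot i) ↔ ¬ A.cs.IsRightDescent w i :=
  ⟨fun h hd => A.rho_coroot_ne_zero w i (le_antisymm (A.rho_coroot_nonpos w i hd) h),
    A.rho_coroot_nonneg w i⟩

theorem rho_coroot_nonneg_or_nonpos (w : A.WeylGroup) (i : ι) :
    0 ≤ A.rho w (coroot i) ∨ A.rho w (coroot i) ≤ 0 := by
  by_cases h : A.cs.IsRightDescent w i
  · exact Or.inr (A.rho_coroot_nonpos w i h)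
  · exact Or.inl (A.rho_coroot_nonneg w i h)

theorem eq_one_of_rho_coroot_nonneg {w : A.WeylGroup} (h : ∀ i, 0 ≤ A.rho w (coroot i)) :
    w = 1 := by
  by_contra hw
  obtain ⟨i, hi⟩ := A.cs.exists_rightDescent_of_ne_one hw
  exact (A.rho_coroot_nonneg_iff w i).1 (h i) hi

/-- Integrality is used twice: to pin down the positive coroots proportional to $h_i$, and to turn
bounds on coroots into finiteness. -/
theorem exists_int_rho (w : A.WeylGroup) (c : ι → ℤ) :
    ∃ d : ι → ℤ, A.rho w (fun i => (c i : ℝ)) = fun i => (d i : ℝ) := by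
  induction w using A.cs.simple_induction_left with
  | one => exact ⟨c, by rw [rho_one]⟩
  | mul_simple_left w i ih =>
    obtain ⟨d, hd⟩ := ih
    refine ⟨d - (∑ j, A.a j i * d j) • Pi.single i 1, ?_⟩
    rw [rho_mul, hd, rho_simple, simpleRoot_apply]
    ext k
    by_cases hk : k = i
    · subst hk
      simp [coroot_self]
    · simp [coroot_of_ne hk, hk]

theorem exists_int_rho_coroot (w : A.WeylGroup) (i : ι) :
    ∃ d : ι → ℤ, A.rho w (coroot i) = fun i => (d i : ℝ) := by
  have : (coroot i : ι → ℝ) = fun j => ((Pi.single i 1 : ι → ℤ) j : ℝ) := by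
    ext j
    by_cases hj : j = i
    · subst hj
      simp [coroot_self]
    · simp [coroot_of_ne hj, hj]
  rw [this]
  exact A.exists_int_rho w _

theorem simple_mem_parabolic {J : Set ι} {i : ι} (hi : i ∈ J) :
    A.cs.simple i ∈ A.parabolic J :=
  Subgroup.subset_closure ⟨i, hi, rfl⟩

theorem parabolic_mono {J K : Set ι} (h : J ⊆ K) : A.parabolic J ≤ A.parabolic K :=
  Subgroup.closure_mono (Set.image_mono h)

theorem parabolic_induction {J : Set ι} {p : ∀ w, w ∈ A.parabolic J → Prop}
    (one : p 1 (one_mem _))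
    (mul : ∀ i (hi : i ∈ J) w (hw : w ∈ A.parabolic J), p w hw →
      p (A.cs.simple i * w) (mul_mem (A.simple_mem_parabolic hi) hw))
    {w : A.WeylGroup} (hw : w ∈ A.parabolic J) : p w hw := by
  refine Subgroup.closure_induction_left one ?_ ?_ hw
  · rintro _ ⟨i, hi, rfl⟩ y hy h
    exact mul i hi y hy h
  · rintro _ ⟨i, hi, rfl⟩ y hy h
    have := mul i hi y hy h
    have h1 : (A.coxeterMatrix.simple i)⁻¹ = A.cs.simple i := A.cs.inv_simple i
    simpa only [h1] using this

theorem rho_apply_of_notMem {J : Set ι} {w : A.WeylGroup} (hw : w ∈ A.parabolic J) (c : ι → ℝ)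
    {k : ι} (hk : k ∉ J) : A.rho w c k = c k := by
  induction hw using A.parabolic_induction with
  | one => rw [rho_one]
  | mul i hi w hw ih =>
    rw [rho_mul, rho_simple, Pi.sub_apply, Pi.smul_apply, ih,
      coroot_of_ne (by rintro rfl; exact hk hi)]
    simp

theorem rho_eq_self {J : Set ι} {w : A.WeylGroup} (hw : w ∈ A.parabolic J) {c : ι → ℝ}
    (hc : ∀ j ∈ J, A.simpleRoot j c = 0) : A.rho w c = c := by
  induction hw using A.parabolic_induction with
  | one => rw [rho_one]
  | mul i hi w hw ih =>
    rw [rho_mul, ih, rho_simple, hc i hi, zero_smul, sub_zero]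

/-- The $k$-th coordinate keeps its value $1$ under $\mathcal W_J$, which excludes the non-positive
alternative. -/
theorem rho_coroot_nonneg_of_notMem {J : Set ι} {w : A.WeylGroup} (hw : w ∈ A.parabolic J)
    {k : ι} (hk : k ∉ J) : 0 ≤ A.rho w (coroot k) := by
  refine (A.rho_coroot_nonneg_or_nonpos w k).resolve_right fun h => ?_
  have := h k
  rw [A.rho_apply_of_notMem hw _ hk, coroot_self] at this
  norm_num at this

/-- The real coroots of the parabolic subgroup `W_J`. -/
def realCoroots (J : Set ι) : Set (ι → ℝ) :=
  {β | ∃ w ∈ A.parabolic J, ∃ j ∈ J, β = A.rho w (coroot j)}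

/-- The positive real coroots of the parabolic subgroup `W_J`. -/
def posCoroots (J : Set ι) : Set (ι → ℝ) := {β | β ∈ A.realCoroots J ∧ 0 ≤ β}

theorem realCoroots_mono {J K : Set ι} (h : J ⊆ K) : A.realCoroots J ⊆ A.realCoroots K := by
  rintro _ ⟨w, hw, j, hj, rfl⟩
  exact ⟨w, A.parabolic_mono h hw, j, h hj, rfl⟩

theorem posCoroots_mono {J K : Set ι} (h : J ⊆ K) : A.posCoroots J ⊆ A.posCoroots K :=
  fun _ hβ => ⟨A.realCoroots_mono h hβ.1, hβ.2⟩

theorem coroot_mem_posCoroots {J : Set ι} {j : ι} (hj : j ∈ J) : coroot j ∈ A.posCoroots J :=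
  ⟨⟨1, one_mem _, j, hj, (A.rho_one _).symm⟩, coroot_nonneg j⟩

theorem rho_mem_realCoroots {J : Set ι} {w : A.WeylGroup} (hw : w ∈ A.parabolic J)
    {β : ι → ℝ} (hβ : β ∈ A.realCoroots J) : A.rho w β ∈ A.realCoroots J := by
  obtain ⟨v, hv, j, hj, rfl⟩ := hβ
  exact ⟨w * v, mul_mem hw hv, j, hj, (A.rho_mul _ _ _).symm⟩

theorem realCoroots_nonneg_or_nonpos {J : Set ι} {β : ι → ℝ} (hβ : β ∈ A.realCoroots J) :
    0 ≤ β ∨ β ≤ 0 := by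
  obtain ⟨v, hv, j, hj, rfl⟩ := hβ
  exact A.rho_coroot_nonneg_or_nonpos v j

/-- Such a coroot is $d\,h_i$ with $d\ge0$ an integer; applying $v^{-1}$ shows that $d$ divides $1$.
-/
theorem eq_coroot_of_mem_posCoroots {J : Set ι} {β : ι → ℝ} (hβ : β ∈ A.posCoroots J) {i : ι}
    (h : ∀ k, k ≠ i → β k = 0) : β = coroot i := by
  obtain ⟨⟨v, hv, j, hj, rfl⟩, h0⟩ := hβ
  obtain ⟨d, hd⟩ := A.exists_int_rho_coroot v j
  obtain ⟨d', hd'⟩ := A.exists_int_rho_coroot v⁻¹ i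
  have h1 : A.rho v (coroot j) = (d i : ℝ) • coroot i := by
    ext k
    by_cases hk : k = i
    · subst hk
      simp [coroot_self, hd]
    · simp [coroot_of_ne hk, h k hk]
  have h2 := congrFun (congrArg (A.rho v⁻¹) h1) j
  rw [rho_inv_rho, map_smul, hd', coroot_self, Pi.smul_apply, smul_eq_mul] at h2
  have h3 : d i * d' j = 1 := by exact_mod_cast h2.symm
  have h4 : 0 ≤ d i := by
    have := h0 i
    rw [hd] at this
    exact Int.cast_nonneg_iff.1 this
  rw [h1, Int.eq_one_of_mul_eq_one_right h4 h3]
  simp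

/-- $\sigma_i$ changes only the $i$-th coordinate, and a positive coroot other than $h_i$ has
another positive coordinate, which forces the sign of the image. -/
theorem rho_simple_mem_posCoroots {J : Set ι} {β : ι → ℝ} (hβ : β ∈ A.posCoroots J) {i : ι}
    (hi : i ∈ J) (h : β ≠ coroot i) : A.rho (A.cs.simple i) β ∈ A.posCoroots J := by
  have h1 := A.rho_mem_realCoroots (A.simple_mem_parabolic hi) hβ.1
  refine ⟨h1, (A.realCoroots_nonneg_or_nonpos h1).resolve_right fun h2 => h ?_⟩
  refine A.eq_coroot_of_mem_posCoroots hβ fun k hk => le_antisymm ?_ (hβ.2 k)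
  have := h2 k
  rw [rho_simple, Pi.sub_apply, Pi.smul_apply, coroot_of_ne hk] at this
  simpa using this

theorem rho_coroot_nonneg_of_mem_minRepsLeft {J : Set ι} {w : A.WeylGroup}
    (hw : w ∈ A.minRepsLeft J) {j : ι} (hj : j ∈ J) : 0 ≤ A.rho w (coroot j) := by
  refine A.rho_coroot_nonneg w j fun hd => ?_
  have h1 := hw _ (A.simple_mem_parabolic hj)
  exact absurd hd (not_lt.2 h1)

theorem exists_minRepsLeft_mul (J : Set ι) (w : A.WeylGroup) :
    ∃ a ∈ A.minRepsLeft J, ∃ b ∈ A.parabolic J, w = a * b := by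
  classical
  have hex : ∃ n, ∃ b ∈ A.parabolic J, A.length (w * b) = n := ⟨_, 1, one_mem _, rfl⟩
  obtain ⟨b, hb, hn⟩ := Nat.find_spec hex
  refine ⟨w * b, fun v hv => ?_, b⁻¹, inv_mem hb, by group⟩
  rw [hn]
  exact Nat.find_min' hex ⟨b * v, mul_mem hb hv, by rw [mul_assoc]⟩

/-- The element $a^{-1}b$ maps every simple coroot to a non-negative vector, hence is $1$. For $j\in
J$, a non-positive image would be supported on $J$, so applying $a$ would make $bh_j$ non-positive
as well. -/
theorem eq_of_rho_coroot_nonneg {J : Set ι} {a b : A.WeylGroup}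
    (ha : ∀ j ∈ J, 0 ≤ A.rho a (coroot j)) (hb : ∀ j ∈ J, 0 ≤ A.rho b (coroot j))
    (h : a⁻¹ * b ∈ A.parabolic J) : a = b := by
  have h1 : a⁻¹ * b = 1 := by
    refine A.eq_one_of_rho_coroot_nonneg fun j => ?_
    by_cases hj : j ∈ J
    · refine (A.rho_coroot_nonneg_or_nonpos _ j).resolve_right fun h2 => ?_
      have h3 : 0 ≤ A.rho a (-A.rho (a⁻¹ * b) (coroot j)) := by
        refine A.rho_nonneg (neg_nonneg.2 h2) fun i hi => ha i ?_
        by_contra hiJ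
        rw [Pi.neg_apply, A.rho_apply_of_notMem h _ hiJ, coroot_of_ne (by rintro rfl; exact hiJ hj)]
          at hi
        simp at hi
      rw [map_neg, ← rho_mul, mul_inv_cancel_left, Left.nonneg_neg_iff] at h3
      exact A.rho_coroot_ne_zero b j (le_antisymm h3 (hb j hj))
    · exact A.rho_coroot_nonneg_of_notMem h hj
  exact (inv_mul_eq_one.1 h1)

theorem mem_minRepsLeft_iff {J : Set ι} {w : A.WeylGroup} :
    w ∈ A.minRepsLeft J ↔ ∀ j ∈ J, 0 ≤ A.rho w (coroot j) := by
  refine ⟨fun hw j hj => A.rho_coroot_nonneg_of_mem_minRepsLeft hw hj, fun h => ?_⟩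
  obtain ⟨a, ha, b, hb, rfl⟩ := A.exists_minRepsLeft_mul J w
  have : a = a * b := A.eq_of_rho_coroot_nonneg
    (fun j hj => A.rho_coroot_nonneg_of_mem_minRepsLeft ha hj) h (by simpa using hb)
  rwa [← this]

theorem eq_of_mem_minRepsLeft {J : Set ι} {a b : A.WeylGroup} (ha : a ∈ A.minRepsLeft J)
    (hb : b ∈ A.minRepsLeft J) (h : a⁻¹ * b ∈ A.parabolic J) : a = b :=
  A.eq_of_rho_coroot_nonneg (A.mem_minRepsLeft_iff.1 ha) (A.mem_minRepsLeft_iff.1 hb) h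

theorem length_inv (w : A.WeylGroup) : A.length w⁻¹ = A.length w := A.cs.length_inv w

theorem inv_mem_minRepsLeft_iff {J : Set ι} {w : A.WeylGroup} :
    w⁻¹ ∈ A.minRepsLeft J ↔ w ∈ A.minRepsRight J := by
  constructor
  · intro h v hv
    have := h v⁻¹ (inv_mem hv)
    rwa [← mul_inv_rev, length_inv, length_inv] at this
  · intro h v hv
    have := h v⁻¹ (inv_mem hv)
    rwa [← length_inv, ← length_inv _ (v⁻¹ * w), mul_inv_rev, inv_inv] at this

theorem exists_mul_minRepsRight (J : Set ι) (w : A.WeylGroup) :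
    ∃ b ∈ A.parabolic J, ∃ a ∈ A.minRepsRight J, w = b * a := by
  obtain ⟨a, ha, b, hb, h⟩ := A.exists_minRepsLeft_mul J w⁻¹
  refine ⟨b⁻¹, inv_mem hb, a⁻¹, A.inv_mem_minRepsLeft_iff.1 (by rwa [inv_inv]), ?_⟩
  rw [← mul_inv_rev, ← h, inv_inv]

theorem eq_of_mem_minRepsRight {J : Set ι} {a b : A.WeylGroup} (ha : a ∈ A.minRepsRight J)
    (hb : b ∈ A.minRepsRight J) (h : a * b⁻¹ ∈ A.parabolic J) : a = b := by
  rw [← inv_mem_minRepsLeft_iff] at ha hb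
  exact inv_injective (A.eq_of_mem_minRepsLeft ha hb (by rwa [inv_inv]))

/-- An antidominant vector is the smallest element of its Weyl group orbit. -/
theorem le_rho_of_antidominant {u : ι → ℝ} (hu : ∀ i, A.simpleRoot i u ≤ 0) (w : A.WeylGroup) :
    u ≤ A.rho w u ∧ (A.rho w u = u → w ∈ A.parabolic {i | A.simpleRoot i u = 0}) := by
  induction hn : A.cs.length w using Nat.strong_induction_on generalizing w with
  | _ n IH =>
  by_cases hw : w = 1
  · subst hw
    exact ⟨(A.rho_one u).ge, fun _ => one_mem _⟩
  obtain ⟨i, hi⟩ := A.cs.exists_rightDescent_of_ne_one hw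
  obtain ⟨h1, h2⟩ := IH _ (hn ▸ hi) (w * A.cs.simple i) rfl
  have h3 : 0 ≤ A.rho (w * A.cs.simple i) (coroot i) := A.rho_coroot_nonneg _ i
    (A.cs.isRightDescent_iff_not_isRightDescent_mul.1 hi)
  -- Expand $wu=(w\sigma_i)(\sigma_iu)$. The added multiple of $(w\sigma_i)h_i$ is non-negative; if
  -- $wu=u$ it must vanish, which gives $\alpha_i(u)=0$ and passes the equality on to $w\sigma_i$.
  have h4 : A.rho w u = A.rho (w * A.cs.simple i) u +
      (-A.simpleRoot i u) • A.rho (w * A.cs.simple i) (coroot i) := by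
    rw [← map_smul, ← map_add, rho_mul, map_add, map_smul, rho_simple_coroot, rho_simple]
    congr 1
    module
  have h5 : 0 ≤ (-A.simpleRoot i u) • A.rho (w * A.cs.simple i) (coroot i) :=
    smul_nonneg (neg_nonneg.2 (hu i)) h3
  refine ⟨h4 ▸ h1.trans (le_add_of_nonneg_right h5), fun h6 => ?_⟩
  rw [h4] at h6
  have h7 : A.rho (w * A.cs.simple i) u = u :=
    le_antisymm ((le_add_of_nonneg_right h5).trans h6.le) h1
  have h8 : A.simpleRoot i u = 0 := by
    rw [h7, add_eq_left, smul_eq_zero, neg_eq_zero] at h6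
    exact h6.resolve_right (A.rho_coroot_ne_zero _ i)
  have h9 := mul_mem (h2 h7) (A.simple_mem_parabolic
    (J := {i | A.simpleRoot i u = 0}) (i := i) h8)
  rwa [CoxeterSystem.simple_mul_simple_cancel_right] at h9

/-- The parabolic subgroup of `J^⊥` fixes the simple coroots of `J`. -/
theorem rho_coroot_eq_self_of_perp {J : Set ι} {w : A.WeylGroup}
    (hw : w ∈ A.parabolic (A.perp J)) {j : ι} (hj : j ∈ J) : A.rho w (coroot j) = coroot j := by
  refine A.rho_eq_self hw fun k hk => ?_
  rw [simpleRoot_coroot]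
  exact_mod_cast (A.zero_iff k j).1 (hk j hj)

theorem commute_of_mem_parabolic_perp {J : Set ι} {v w : A.WeylGroup} (hv : v ∈ A.parabolic J)
    (hw : w ∈ A.parabolic (A.perp J)) : v * w = w * v := by
  have key : ∀ j ∈ J, ∀ k ∈ A.perp J, Commute (A.cs.simple j) (A.cs.simple k) := by
    intro j hj k hk
    have h1 : A.a k j = 0 := hk j hj
    have hjk : j ≠ k := by
      rintro rfl
      rw [A.diag] at h1
      norm_num at h1
    have hM : A.coxeterMatrix j k = 2 := by
      simp [coxeterMatrix, hjk, h1, exponent]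
    have h2 := A.cs.simple_mul_simple_pow j k
    rw [hM, pow_two] at h2
    have h3 := eq_inv_of_mul_eq_one_left h2
    rwa [mul_inv_rev, CoxeterSystem.inv_simple, CoxeterSystem.inv_simple] at h3
  change Commute v w
  induction hv using A.parabolic_induction with
  | one => exact Commute.one_left w
  | mul j hj v hv ih =>
    refine Commute.mul_left ?_ ih
    clear ih
    induction hw using A.parabolic_induction with
    | one => exact Commute.one_right _
    | mul k hk w hw ih => exact Commute.mul_right (key j hj k hk) ih

theorem exists_mul_of_mem_parabolic_union_perp {J : Set ι} {w : A.WeylGroup}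
    (hw : w ∈ A.parabolic (J ∪ A.perp J)) :
    ∃ a ∈ A.parabolic J, ∃ b ∈ A.parabolic (A.perp J), w = a * b := by
  induction hw using A.parabolic_induction with
  | one => exact ⟨1, one_mem _, 1, one_mem _, by simp⟩
  | mul i hi w hw ih =>
    obtain ⟨a, ha, b, hb, rfl⟩ := ih
    rcases hi with hi | hi
    · exact ⟨A.cs.simple i * a, mul_mem (A.simple_mem_parabolic hi) ha, b, hb, by
        rw [mul_assoc]⟩
    · refine ⟨a, ha, A.cs.simple i * b, mul_mem (A.simple_mem_parabolic hi) hb, ?_⟩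
      rw [← mul_assoc, ← mul_assoc,
        A.commute_of_mem_parabolic_perp ha (A.simple_mem_parabolic hi)]

theorem mul_mem_minRepsLeft {J : Set ι} {w v : A.WeylGroup}
    (hw : w ∈ A.minRepsLeft (J ∪ A.perp J)) (hv : v ∈ A.parabolic (A.perp J)) :
    w * v ∈ A.minRepsLeft J := by
  refine A.mem_minRepsLeft_iff.2 fun j hj => ?_
  rw [rho_mul, A.rho_coroot_eq_self_of_perp hv hj]
  exact A.mem_minRepsLeft_iff.1 hw j (Or.inl hj)

/-- In $x=wab$ with $ab\in\mathcal W_\Theta\mathcal W_{\Theta^\bot}$ (here $J=\Theta$), the elements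
$wb$ and $x=wba$ are minimal in the same coset of $\mathcal W_\Theta$, so they agree. -/
theorem exists_mul_of_mem_minRepsLeft {J : Set ι} {x : A.WeylGroup} (hx : x ∈ A.minRepsLeft J) :
    ∃ w ∈ A.minRepsLeft (J ∪ A.perp J), ∃ v ∈ A.parabolic (A.perp J), x = w * v := by
  obtain ⟨w, hw, n, hn, rfl⟩ := A.exists_minRepsLeft_mul (J ∪ A.perp J) x
  obtain ⟨a, ha, b, hb, rfl⟩ := A.exists_mul_of_mem_parabolic_union_perp hn
  refine ⟨w, hw, b, hb, (A.eq_of_mem_minRepsLeft (A.mul_mem_minRepsLeft hw hb) hx ?_).symm⟩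
  rw [A.commute_of_mem_parabolic_perp ha hb]
  simpa [mul_assoc] using ha

theorem eq_of_mul_eq_mul {J : Set ι} {w v w' v' : A.WeylGroup}
    (hw : w ∈ A.minRepsLeft (J ∪ A.perp J)) (hv : v ∈ A.parabolic (A.perp J))
    (hw' : w' ∈ A.minRepsLeft (J ∪ A.perp J)) (hv' : v' ∈ A.parabolic (A.perp J))
    (h : w * v = w' * v') : w = w' ∧ v = v' := by
  have h1 : w = w' := by
    refine A.eq_of_mem_minRepsLeft hw hw' ?_
    have : w⁻¹ * w' = v * v'⁻¹ := by
      rw [inv_mul_eq_iff_eq_mul, ← mul_assoc, h, mul_inv_cancel_right]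
    rw [this]
    exact A.parabolic_mono Set.subset_union_right (mul_mem hv (inv_mem hv'))
  subst h1
  exact ⟨rfl, mul_left_cancel h⟩

theorem bijOn_mul_minRepsLeft (J : Set ι) :
    Set.BijOn (fun p : A.WeylGroup × A.WeylGroup => p.1 * p.2)
      (A.minRepsLeft (J ∪ A.perp J) ×ˢ (A.parabolic (A.perp J) : Set A.WeylGroup))
      (A.minRepsLeft J) := by
  refine ⟨fun p hp => A.mul_mem_minRepsLeft hp.1 hp.2, fun p hp q hq h => ?_, fun x hx => ?_⟩
  · exact Prod.ext_iff.2 (A.eq_of_mul_eq_mul hp.1 hp.2 hq.1 hq.2 h)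
  · obtain ⟨w, hw, v, hv, rfl⟩ := A.exists_mul_of_mem_minRepsLeft hx
    exact ⟨(w, v), ⟨hw, hv⟩, rfl⟩

theorem bijOn_mul_minRepsRight (J : Set ι) :
    Set.BijOn (fun p : A.WeylGroup × A.WeylGroup => p.1 * p.2)
      ((A.parabolic (A.perp J) : Set A.WeylGroup) ×ˢ A.minRepsRight (J ∪ A.perp J))
      (A.minRepsRight J) := by
  refine ⟨fun p hp => ?_, fun p hp q hq h => ?_, fun x hx => ?_⟩
  · rw [← inv_mem_minRepsLeft_iff, mul_inv_rev]
    exact A.mul_mem_minRepsLeft (A.inv_mem_minRepsLeft_iff.2 hp.2) (inv_mem hp.1)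
  · have h' := congrArg (·⁻¹) h
    simp only [mul_inv_rev] at h'
    obtain ⟨h1, h2⟩ := A.eq_of_mul_eq_mul (A.inv_mem_minRepsLeft_iff.2 hp.2) (inv_mem hp.1)
      (A.inv_mem_minRepsLeft_iff.2 hq.2) (inv_mem hq.1) h'
    exact Prod.ext (inv_injective h2) (inv_injective h1)
  · obtain ⟨w, hw, v, hv, h⟩ := A.exists_mul_of_mem_minRepsLeft (A.inv_mem_minRepsLeft_iff.2 hx)
    refine ⟨(v⁻¹, w⁻¹), ⟨inv_mem hv, A.inv_mem_minRepsLeft_iff.1 (by rwa [inv_inv])⟩, ?_⟩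
    exact (mul_inv_rev w v).symm.trans (by rw [← h, inv_inv])

end Parabolic

end GCM

namespace GCM

/-! ### Finite type, antidominant supports and a theorem of the alternative. -/

section MatrixTypes

/-- A minimum principle: at an index minimizing $v_i/u_i$, a negative ratio would force $(Mv)_i<0$.
Then `hconn`, which expresses indecomposability, spreads a zero of $v$ to all indices. A kernel
vector and its negative would both be positive, so $\det M\ne0$. -/
theorem isFiniteTypeMatrix_of_pos {κ : Type*} [Fintype κ] [DecidableEq κ] [Nonempty κ]
    {M : Matrix κ κ ℝ} (hM : ∀ i j, i ≠ j → M i j ≤ 0)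
    (hconn : ∀ S : Set κ, S.Nonempty → (∀ i ∈ S, ∀ j, M i j ≠ 0 → j ∈ S) → S = Set.univ)
    {u : κ → ℝ} (hu : ∀ k, 0 < u k) (hMu : ∀ k, 0 < M.mulVec u k) : IsFiniteTypeMatrix M := by
  have key : ∀ v : κ → ℝ, (∀ k, 0 ≤ M.mulVec v k) → (∀ k, 0 < v k) ∨ v = 0 := by
    intro v hv
    have h0 : ∀ k, 0 ≤ v k := by
      obtain ⟨i, hi⟩ := Finite.exists_min fun k => v k / u k
      by_contra! hneg
      obtain ⟨k, hk⟩ := hneg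
      have ht : v i / u i < 0 := (hi k).trans_lt (div_neg_of_neg_of_pos hk (hu k))
      have h1 : ∀ j, v i / u i * u j ≤ v j := fun j => by
        rw [← le_div_iff₀ (hu j)]
        exact hi j
      have h2 : M.mulVec v i ≤ v i / u i * M.mulVec u i := by
        simp only [Matrix.mulVec, dotProduct, Finset.mul_sum]
        refine Finset.sum_le_sum fun j _ => ?_
        by_cases hj : i = j
        · subst hj
          have := (hu i).ne'
          field_simp
          exact le_rfl
        · have := mul_le_mul_of_nonpos_left (h1 j) (hM i j hj)
          linarith
      have := hv i
      nlinarith [mul_neg_of_neg_of_pos ht (hMu i)]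
    by_cases hz : ∃ i, v i = 0
    · right
      have := hconn {i | v i = 0} hz (fun i hi j hij => ?_)
      · ext k
        exact (this.symm ▸ Set.mem_univ k : k ∈ {i | v i = 0})
      · have hterm : ∀ j ∈ Finset.univ, M i j * v j ≤ 0 := fun j _ => by
          by_cases hj : i = j
          · subst hj
            rw [Set.mem_ofPred_eq] at hi
            simp [hi]
          · exact mul_nonpos_of_nonpos_of_nonneg (hM i j hj) (h0 j)
        have hsum : ∑ j, M i j * v j = 0 :=
          le_antisymm (Finset.sum_nonpos hterm) (hv i)
        have := (Finset.sum_eq_zero_iff_of_nonpos hterm).1 hsum j (Finset.mem_univ j)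
        exact (mul_eq_zero.1 this).resolve_left hij
    · left
      push Not at hz
      exact fun k => lt_of_le_of_ne (h0 k) (hz k).symm
  refine ⟨fun hdet => ?_, ⟨u, hu, hMu⟩, key⟩
  obtain ⟨v, hv, hMv⟩ := Matrix.exists_mulVec_eq_zero_iff.2 hdet
  have h1 := (key v (fun k => by rw [hMv]; exact le_rfl)).resolve_right hv
  have h2 := (key (-v) (fun k => by rw [Matrix.mulVec_neg, hMv]; simp)).resolve_right
    (neg_ne_zero.2 hv)
  obtain ⟨k⟩ := ‹Nonempty κ›
  have h3 := h1 k
  have h4 := h2 k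
  rw [Pi.neg_apply] at h4
  linarith

variable {ι : Type*} [Fintype ι] [DecidableEq ι] (A : GCM ι)

/-- The subset `Θ` is the support of a non-negative antidominant coroot combination. -/
def IsAntidominantSupport (Θ : Set ι) : Prop :=
  ∃ u : ι → ℝ, (∀ i ∈ Θ, 0 < u i) ∧ (∀ i ∉ Θ, u i = 0) ∧ ∀ j, A.simpleRoot j u ≤ 0

theorem simpleRoot_nonpos {y : ι → ℝ} (hy : 0 ≤ y) {j : ι} (hj : y j = 0) :
    A.simpleRoot j y ≤ 0 := by
  rw [simpleRoot_apply]
  refine Finset.sum_nonpos fun i _ => ?_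
  by_cases h : i = j
  · subst h
    simp [hj]
  · exact mul_nonpos_of_nonpos_of_nonneg (by exact_mod_cast A.nonpos i j h) (hy i)

theorem simpleRoot_neg {y : ι → ℝ} (hy : 0 ≤ y) {i j : ι} (hj : y j = 0) (hi : 0 < y i)
    (hij : A.a i j ≠ 0) : A.simpleRoot j y < 0 := by
  have hne : i ≠ j := by rintro rfl; exact hi.ne' hj
  rw [simpleRoot_apply]
  refine Finset.sum_neg' (fun k _ => ?_) ⟨i, Finset.mem_univ i, ?_⟩
  · by_cases h : k = j
    · subst h
      simp [hj]
    · exact mul_nonpos_of_nonpos_of_nonneg (by exact_mod_cast A.nonpos k j h) (hy k)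
  · exact mul_neg_of_neg_of_pos (by exact_mod_cast lt_of_le_of_ne (A.nonpos i j hne) hij) hi

theorem isAntidominantSupport_support {y : ι → ℝ} (hy : 0 ≤ y)
    (h : ∀ j, A.simpleRoot j y ≤ 0) : A.IsAntidominantSupport {i | y i ≠ 0} :=
  ⟨y, fun i hi => lt_of_le_of_ne (hy i) (Ne.symm hi), fun _ hi => not_not.1 hi, h⟩

theorem IsAntidominantSupport.nonneg {Θ : Set ι} {u : ι → ℝ} (h1 : ∀ i ∈ Θ, 0 < u i)
    (h2 : ∀ i ∉ Θ, u i = 0) : 0 ≤ u := fun i => by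
  by_cases hi : i ∈ Θ
  · exact (h1 i hi).le
  · exact (h2 i hi).ge

variable {A} in
theorem IsAntidominantSupport.union {Θ Θ' : Set ι} (h : A.IsAntidominantSupport Θ)
    (h' : A.IsAntidominantSupport Θ') : A.IsAntidominantSupport (Θ ∪ Θ') := by
  obtain ⟨u, h1, h2, h3⟩ := h
  obtain ⟨u', h1', h2', h3'⟩ := h'
  refine ⟨u + u', ?_, ?_, fun j => ?_⟩
  · have h0 := IsAntidominantSupport.nonneg h1 h2
    have h0' := IsAntidominantSupport.nonneg h1' h2'
    rintro i (hi | hi)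
    · exact add_pos_of_pos_of_nonneg (h1 i hi) (h0' i)
    · exact add_pos_of_nonneg_of_pos (h0 i) (h1' i hi)
  · intro i hi
    rw [Set.mem_union, not_or] at hi
    rw [Pi.add_apply, h2 i hi.1, h2' i hi.2, add_zero]
  · rw [map_add]
    exact add_nonpos (h3 j) (h3' j)

variable {A} in
theorem IsAntidominantSupport.insert {Θ : Set ι} (h : A.IsAntidominantSupport Θ) {j k : ι}
    (hj : j ∈ Θ) (hk : k ∉ Θ) (hjk : A.a j k ≠ 0) : A.IsAntidominantSupport (insert k Θ) := by
  obtain ⟨u, h1, h2, h3⟩ := h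
  have h0 := IsAntidominantSupport.nonneg h1 h2
  have hneg := A.simpleRoot_neg h0 (h2 k hk) (h1 j hj) hjk
  -- Since $\alpha_k(h_k)=2$, this coefficient makes $\alpha_k$ vanish on the new vector; for $l\ne
  -- k$ the value of $\alpha_l$ can only decrease.
  refine ⟨u + (-A.simpleRoot k u / 2) • coroot k, ?_, ?_, fun l => ?_⟩
  · rintro i (rfl | hi)
    · rw [Pi.add_apply, Pi.smul_apply, coroot_self, h2 i hk, smul_eq_mul]
      linarith
    · rw [Pi.add_apply, Pi.smul_apply, coroot_of_ne (by rintro rfl; exact hk hi)]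
      simpa using h1 i hi
  · intro i hi
    rw [Set.mem_insert_iff, not_or] at hi
    rw [Pi.add_apply, Pi.smul_apply, coroot_of_ne hi.1, h2 i hi.2]
    simp
  · rw [map_add, map_smul, simpleRoot_coroot, smul_eq_mul]
    by_cases hl : k = l
    · subst hl
      rw [A.diag]
      push_cast
      linarith
    · have : (A.a k l : ℝ) ≤ 0 := by exact_mod_cast A.nonpos k l hl
      nlinarith [h3 l]

/-- Antidominant supports are closed under unions, so a maximal one inside $J$ is the greatest. -/
theorem exists_maximal_antidominantSupport (J : Set ι) :
    ∃ Θ ⊆ J, A.IsAntidominantSupport Θ ∧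
      ∀ Θ' ⊆ J, A.IsAntidominantSupport Θ' → Θ' ⊆ Θ := by
  obtain ⟨Θ, hΘ⟩ := (Set.toFinite {Θ : Set ι | Θ ⊆ J ∧ A.IsAntidominantSupport Θ}).exists_maximal
    ⟨∅, Set.empty_subset J, 0, by simp, by simp, by simp⟩
  refine ⟨Θ, hΘ.prop.1, hΘ.prop.2, fun Θ' h1 h2 => ?_⟩
  exact Set.subset_union_right.trans (hΘ.le_of_ge (y := Θ ∪ Θ')
    ⟨Set.union_subset hΘ.prop.1 h1, hΘ.prop.2.union h2⟩ Set.subset_union_left)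

/-- Ville's theorem of the alternative for the submatrix of `A` on `K`. -/
theorem exists_pos_or_exists_nonneg (K : Set ι) :
    (∃ v : ι → ℝ, (∀ k ∈ K, 0 < v k) ∧ (∀ k ∉ K, v k = 0) ∧ ∀ k ∈ K, 0 < ∑ j, A.a k j * v j) ∨
    ∃ y : ι → ℝ, y ≠ 0 ∧ 0 ≤ y ∧ (∀ k ∉ K, y k = 0) ∧ ∀ j ∈ K, A.simpleRoot j y ≤ 0 := by
  by_cases hv : ∃ v : ι → ℝ, (∀ k ∈ K, 0 < v k) ∧ (∀ k ∉ K, v k = 0) ∧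
      ∀ k ∈ K, 0 < ∑ j, A.a k j * v j
  · exact Or.inl hv
  right
  let L : (ι → ℝ) →ₗ[ℝ] (ι → ℝ) := (A.a.map (fun z : ℤ => (z : ℝ))).mulVecLin
  have hL : ∀ v k, L v k = ∑ j, A.a k j * v j := fun v k => by
    simp [L, Matrix.mulVec, dotProduct]
  let Q : Set (ι → ℝ) := {v | (∀ k ∈ K, 0 < v k) ∧ ∀ k ∉ K, v k = 0}
  let T : Set (ι → ℝ) := {x | ∀ k ∈ K, 0 < x k}
  have hTo : IsOpen T := by
    have : T = ⋂ k ∈ K, {x : ι → ℝ | 0 < x k} := by ext; simp [T]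
    rw [this]
    exact K.toFinite.isOpen_biInter fun k _ => isOpen_lt continuous_const (continuous_apply k)
  have hTc : Convex ℝ T := by
    intro x hx y hy a b ha hb hab k hk
    have h1 := hx k hk
    have h2 := hy k hk
    simp only [Pi.add_apply, Pi.smul_apply, smul_eq_mul]
    rcases ha.eq_or_lt with rfl | ha
    · obtain rfl : b = 1 := by linarith
      linarith
    · nlinarith [mul_pos ha h1, mul_nonneg hb h2.le]
  have hQc : Convex ℝ Q := by
    intro x hx y hy a b ha hb hab
    refine ⟨hTc hx.1 hy.1 ha hb hab, fun k hk => ?_⟩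
    simp [hx.2 k hk, hy.2 k hk]
  have hdisj : Disjoint T (L '' Q) := by
    rw [Set.disjoint_left]
    rintro _ hx ⟨v, hvQ, rfl⟩
    exact hv ⟨v, hvQ.1, hvQ.2, fun k hk => by rw [← hL]; exact hx k hk⟩
  -- If no such $v$ exists, separate the open cone of vectors positive on $K$ from the image of the
  -- positive vectors supported on $K$. Homogeneity reduces the threshold $c$ to $0$, perturbation
  -- extends the inequalities to the closed cones, and the coefficients of $-f$ form $y$.
  obtain ⟨f, c, hf1, hf2⟩ := geometric_hahn_banach_open hTc hTo (hQc.linear_image L) hdisj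
  have hone : (1 : ι → ℝ) ∈ T := fun k _ => one_pos
  have hc : 0 ≤ c := by
    by_contra! hc
    have h1 := hf1 1 hone
    have h2 := hf1 ((c / (2 * f 1)) • 1) fun k hk => by
      have : 0 < c / (2 * f 1) := div_pos_of_neg_of_neg hc (by linarith)
      simpa using this
    rw [map_smul, smul_eq_mul] at h2
    have : c / (2 * f 1) * f 1 = c / 2 := by
      have : f 1 ≠ 0 := by linarith
      field_simp
    linarith
  have hfT : ∀ x ∈ T, f x ≤ 0 := by
    intro x hx
    by_contra! h1
    have h2 := hf1 (((c + 1) / f x) • x) fun k hk =>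
      mul_pos (div_pos (by linarith) h1) (hx k hk)
    rw [map_smul, smul_eq_mul, div_mul_cancel₀ _ h1.ne'] at h2
    linarith
  have hfT' : ∀ x : ι → ℝ, (∀ k ∈ K, 0 ≤ x k) → f x ≤ 0 := by
    intro x hx
    by_contra! h1
    have h3 := hfT 1 hone
    have h2 := hfT (x + (f x / (2 * (1 - f 1))) • 1) fun k hk => by
      have : 0 < f x / (2 * (1 - f 1)) := div_pos h1 (by linarith)
      simpa using add_pos_of_nonneg_of_pos (hx k hk) this
    rw [map_add, map_smul, smul_eq_mul] at h2
    have h4 : f x / (2 * (1 - f 1)) * (1 - f 1) = f x / 2 := by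
      have : 1 - f 1 ≠ 0 := by linarith
      field_simp
    have h5 : 0 < f x / (2 * (1 - f 1)) := div_pos h1 (by linarith)
    nlinarith
  have hfQ : ∀ v : ι → ℝ, (∀ k ∈ K, 0 ≤ v k) → (∀ k ∉ K, v k = 0) → 0 ≤ f (L v) := by
    intro v hv1 hv2
    by_contra! h1
    let o : ι → ℝ := K.indicator 1
    have ho1 : ∀ k ∈ K, o k = 1 := fun k hk => by simp [o, hk]
    have ho2 : ∀ k ∉ K, o k = 0 := fun k hk => by simp [o, hk]
    have hs : 0 < -f (L v) / (2 * (1 + |f (L o)|)) := div_pos (by linarith) (by positivity)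
    have h2 := hf2 (L (v + (-f (L v) / (2 * (1 + |f (L o)|))) • o)) ⟨_, ⟨fun k hk => by
      simpa [ho1 k hk] using add_pos_of_nonneg_of_pos (hv1 k hk) hs, fun k hk => by
      simp [ho2 k hk, hv2 k hk]⟩, rfl⟩
    rw [map_add, map_smul, map_add, map_smul, smul_eq_mul] at h2
    have h3 : -f (L v) / (2 * (1 + |f (L o)|)) * (1 + |f (L o)|) = -f (L v) / 2 := by
      have : 1 + |f (L o)| ≠ 0 := by positivity
      field_simp
    nlinarith [le_abs_self (f (L o))]
  have hfcoord : ∀ x : ι → ℝ, f x = ∑ i, f (coroot i) * x i := by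
    intro x
    conv_lhs => rw [eq_sum_smul_coroot x]
    rw [map_sum]
    exact Finset.sum_congr rfl fun i _ => by rw [map_smul, smul_eq_mul, mul_comm]
  have hLcol : ∀ i j, L (coroot j) i = A.a i j := fun i j => by
    rw [hL]
    simp [coroot, Pi.single_apply]
  refine ⟨fun i => -f (coroot i), fun h0 => ?_, fun i => ?_, fun k hk => ?_, fun j hj => ?_⟩
  · have hf0 : ∀ x, f x = 0 := fun x => by
      rw [hfcoord]
      refine Finset.sum_eq_zero fun i _ => ?_
      have := congrFun h0 i
      simp only [Pi.zero_apply, neg_eq_zero] at this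
      rw [this, zero_mul]
    have h1 := hf1 1 hone
    have h2 := hf2 (L (K.indicator 1)) ⟨_, ⟨fun k hk => by simp [hk], fun k hk => by simp [hk]⟩, rfl⟩
    rw [hf0] at h1 h2
    linarith
  · have := hfT' (coroot i) fun k _ => coroot_nonneg i k
    simpa using this
  · have h0 : ∀ l ∈ K, coroot k l = 0 := fun l hl => coroot_of_ne (by rintro rfl; exact hk hl)
    have h1 := hfT' (coroot k) fun l hl => (h0 l hl).ge
    have h2 := hfT' (-coroot k) fun l hl => by rw [Pi.neg_apply, h0 l hl, neg_zero]
    rw [map_neg] at h2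
    simp only [neg_eq_zero]
    linarith
  · have h1 := hfQ (coroot j) (fun k _ => coroot_nonneg j k)
      fun k hk => coroot_of_ne (by rintro rfl; exact hk hj)
    rw [hfcoord] at h1
    rw [simpleRoot_apply, ← neg_nonneg, ← Finset.sum_neg_distrib]
    refine h1.trans_eq (Finset.sum_congr rfl fun i _ => ?_)
    rw [hLcol]
    ring

/-- Every `J` is the orthogonal union of an antidominant support `Θ` and a set `J \ Θ` on which
`A` maps some positive vector to a positive vector. -/
theorem exists_antidominantSupport_decomposition (J : Set ι) :
    ∃ Θ ⊆ J, A.IsAntidominantSupport Θ ∧ J \ Θ ⊆ A.perp Θ ∧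
      ∃ v : ι → ℝ, (∀ k ∈ J \ Θ, 0 < v k) ∧ (∀ k ∉ J \ Θ, v k = 0) ∧
        ∀ k ∈ J \ Θ, 0 < ∑ j, A.a k j * v j := by
  obtain ⟨Θ, hΘJ, hΘ, hmax⟩ := A.exists_maximal_antidominantSupport J
  refine ⟨Θ, hΘJ, hΘ, fun k hk j hj => ?_, (A.exists_pos_or_exists_nonneg (J \ Θ)).resolve_right ?_⟩
  · by_contra hkj
    exact hk.2 (hmax _ (Set.insert_subset hk.1 hΘJ)
      (hΘ.insert hj hk.2 fun h => hkj ((A.zero_iff j k).1 h)) (Set.mem_insert k Θ))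
  -- The support of $y$ would itself be antidominant and disjoint from $\Theta$, against the choice
  -- of $\Theta$ as the greatest one.
  · rintro ⟨y, hy0, hy, hyK, hyr⟩
    have h1 : {i | y i ≠ 0} ⊆ J \ Θ := fun i hi => by
      by_contra h
      exact hi (hyK i h)
    have h2 := hmax _ (h1.trans Set.sdiff_subset) (A.isAntidominantSupport_support hy fun j => by
      by_cases hj : j ∈ J \ Θ
      · exact hyr j hj
      · exact A.simpleRoot_nonpos hy (hyK j hj))
    exact hy0 (funext fun i => by
      by_contra h
      exact (h1 h).2 (h2 h))

end MatrixTypes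

/-! ### Special sets are the antidominant supports. -/

section Special

variable {ι : Type*} [Fintype ι] (A : GCM ι)

theorem sum_supp_eq {Θ : Set ι} (c : (A.graph.induce Θ).ConnectedComponent)
    [Fintype c.supp] (F : ι → ℝ) (h : ∀ (i : ι) (hi : i ∈ Θ), (⟨i, hi⟩ : Θ) ∉ c.supp → F i = 0)
    (h' : ∀ i ∉ Θ, F i = 0) : ∑ i : c.supp, F i.1.1 = ∑ i, F i := by
  refine Finset.sum_bij_ne_zero (fun i _ _ => i.1.1) (fun _ _ _ => Finset.mem_univ _) ?_ ?_ ?_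
  · intro i _ _ j _ _ hij
    exact Subtype.ext (Subtype.ext hij)
  · intro i _ hi
    have h1 : i ∈ Θ := by
      by_contra hΘ
      exact hi (h' i hΘ)
    have h2 : (⟨i, h1⟩ : Θ) ∈ c.supp := by
      by_contra hc
      exact hi (h i h1 hc)
    exact ⟨⟨⟨i, h1⟩, h2⟩, Finset.mem_univ _, hi, rfl⟩
  · intros
    rfl

theorem entry_eq_zero_of_notMem_supp {Θ : Set ι} (c : (A.graph.induce Θ).ConnectedComponent)
    {i j : Θ} (hi : i ∈ c.supp) (hj : j ∉ c.supp) : A.a i.1 j.1 = 0 := by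
  by_contra h
  refine hj ?_
  have hadj : (A.graph.induce Θ).Adj i j := ⟨fun hij => hj (Subtype.ext hij ▸ hi), h⟩
  exact (SimpleGraph.ConnectedComponent.mem_supp_congr_adj c hadj).1 hi

variable [DecidableEq ι]

/-- Forward: in the decomposition of $\Theta$, a component meeting the complement of the
antidominant part lies wholly in it, and the positive vector there makes it of finite type.
Backward: on a component of finite type with $Mv>0$, the sum $\sum u_i(Mv)_i$ is positive, yet it
equals $\sum\alpha_j(u)v_j\le0$. -/
theorem isSpecial_iff {Θ : Set ι} : A.IsSpecial Θ ↔ A.IsAntidominantSupport Θ := by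
  classical
  constructor
  · intro h
    obtain ⟨Θ₀, hΘ₀, hAD, hperp, v, hv1, hv2, hv3⟩ := A.exists_antidominantSupport_decomposition Θ
    suffices h1 : Θ ⊆ Θ₀ by rwa [hΘ₀.antisymm h1] at hAD
    by_contra hsub
    obtain ⟨k, hk, hk0⟩ := Set.not_subset.1 hsub
    let c := (A.graph.induce Θ).connectedComponentMk ⟨k, hk⟩
    have hc : ∀ i ∈ c.supp, i.1 ∉ Θ₀ := by
      intro i hi
      obtain ⟨p⟩ := (SimpleGraph.ConnectedComponent.exact hi).symm
      have : ∀ (i j : Θ) (p : (A.graph.induce Θ).Walk i j), i.1 ∉ Θ₀ → j.1 ∉ Θ₀ := by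
        intro i j p
        induction p with
        | nil => exact id
        | cons hadj _ ih =>
          refine fun h1 => ih fun h2 => ?_
          exact hadj.2 (hperp ⟨Subtype.coe_prop _, h1⟩ _ h2)
      exact this _ _ p hk0
    have : Nonempty c.supp := ⟨⟨⟨k, hk⟩, rfl⟩⟩
    suffices hfin : IsFiniteTypeMatrix
        (Matrix.of fun i j : c.supp => ((A.a i.1.1 j.1.1 : ℤ) : ℝ)) from h c (by convert hfin)
    refine isFiniteTypeMatrix_of_pos (u := fun i => v i.1.1) ?_ ?_ ?_ ?_
    · intro i j hij
      have : i.1.1 ≠ j.1.1 := fun h => hij (Subtype.ext (Subtype.ext h))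
      exact Int.cast_nonpos.2 (A.nonpos _ _ this)
    · intro S ⟨i, hiS⟩ hS
      refine Set.eq_univ_of_forall fun j => ?_
      have hreach : (A.graph.induce Θ).Reachable i.1 j.1 :=
        SimpleGraph.ConnectedComponent.exact (i.2.trans j.2.symm)
      obtain ⟨p⟩ := hreach
      have : ∀ (i j : Θ) (_ : (A.graph.induce Θ).Walk i j),
          (∃ hi : i ∈ c.supp, (⟨i, hi⟩ : c.supp) ∈ S) →
            ∃ hj : j ∈ c.supp, (⟨j, hj⟩ : c.supp) ∈ S := by
        intro i j p
        induction p with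
        | nil => exact id
        | cons hadj _ ih =>
          rintro ⟨h1, h2⟩
          have h3 := (SimpleGraph.ConnectedComponent.mem_supp_congr_adj c hadj).1 h1
          refine ih ⟨h3, hS _ h2 ⟨_, h3⟩ ?_⟩
          exact Int.cast_ne_zero.2 hadj.2
      exact (this i.1 j.1 p ⟨i.2, hiS⟩).2
    · exact fun i => hv1 _ ⟨i.1.2, hc i.1 i.2⟩
    · intro i
      have := hv3 i.1.1 ⟨i.1.2, hc i.1 i.2⟩
      refine this.trans_eq (A.sum_supp_eq c (fun j => A.a i.1.1 j * v j) (fun j hj hjc => ?_)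
        fun j hj => ?_).symm
      · have := A.entry_eq_zero_of_notMem_supp c i.2 hjc
        simp only at this
        simp [this]
      · simp [hv2 j fun h => hj h.1]
  · rintro ⟨u, hu1, hu2, hu3⟩ c ⟨-, ⟨v, hv, hMv⟩, -⟩
    obtain ⟨x, hx⟩ := c.exists_rep
    have hMv' : ∀ i : c.supp, 0 < ∑ j : c.supp, (A.a i.1.1 j.1.1 : ℝ) * v j := fun i => by
      have := hMv i
      simp only [Matrix.mulVec, dotProduct, Matrix.of_apply] at this
      convert this
    have h1 : 0 < ∑ i : c.supp, u i.1.1 * ∑ j : c.supp, (A.a i.1.1 j.1.1 : ℝ) * v j :=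
      Finset.sum_pos (fun i _ => mul_pos (hu1 _ i.1.2) (hMv' i)) ⟨⟨x, hx⟩, Finset.mem_univ _⟩
    refine h1.not_ge ?_
    simp_rw [Finset.mul_sum]
    rw [Finset.sum_comm]
    refine Finset.sum_nonpos fun j _ => ?_
    have h2 : ∑ i : c.supp, (A.a i.1.1 j.1.1 : ℝ) * u i.1.1 ≤ 0 := by
      rw [A.sum_supp_eq c (fun i => (A.a i j.1.1 : ℝ) * u i), ← simpleRoot_apply]
      · exact hu3 _
      · intro i hi hic
        have := (A.zero_iff _ _).1 (A.entry_eq_zero_of_notMem_supp c j.2 hic)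
        simp only at this
        simp [this]
      · intro i hi
        simp [hu2 i hi]
    have h3 : ∑ i : c.supp, u i.1.1 * ((A.a i.1.1 j.1.1 : ℝ) * v j) =
        (∑ i : c.supp, (A.a i.1.1 j.1.1 : ℝ) * u i.1.1) * v j := by
      rw [Finset.sum_mul]
      exact Finset.sum_congr rfl fun i _ => by ring
    rw [h3]
    exact mul_nonpos_of_nonpos_of_nonneg h2 (hv j).le

end Special

/-! ### The invariant form and finiteness of coroots. -/

section Form

variable {ι : Type*} [Fintype ι] [DecidableEq ι] (A : GCM ι)

variable {A} in
theorem IsSymmetrizable.exists_symmetrizer (hA : A.IsSymmetrizable) :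
    ∃ ε : ι → ℝ, (∀ i, 0 < ε i) ∧ ∀ i j, A.a i j * ε j = A.a j i * ε i := by
  obtain ⟨ε, B, hε, hB, h⟩ := hA
  refine ⟨fun i => ε i, fun i => Rat.cast_pos.2 (hε i), fun i j => ?_⟩
  have h1 : ∀ i j, (A.a i j : ℚ) = ε i * B i j := fun i j => by
    have := congrFun (congrFun h i) j
    simpa [Matrix.diagonal_mul] using this
  have h2 : (A.a i j : ℚ) * ε j = A.a j i * ε i := by
    rw [h1, h1, hB.apply i j]
    ring
  have h3 := congrArg (fun q : ℚ => (q : ℝ)) h2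
  push_cast at h3
  exact h3

/-- The bilinear form on coroot space defined by a symmetrizer `ε`. -/
noncomputable def form (ε : ι → ℝ) : (ι → ℝ) →ₗ[ℝ] (ι → ℝ) →ₗ[ℝ] ℝ :=
  ∑ i, ε i • (LinearMap.proj i).smulRight (A.simpleRoot i)

theorem form_apply (ε x y : ι → ℝ) : A.form ε x y = ∑ i, ε i * (x i * A.simpleRoot i y) := by
  simp [form]

theorem form_coroot_left (ε : ι → ℝ) (i : ι) (y : ι → ℝ) :
    A.form ε (coroot i) y = ε i * A.simpleRoot i y := by
  rw [form_apply, Finset.sum_eq_single i]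
  · rw [coroot_self, one_mul]
  · intro j _ hj
    rw [coroot_of_ne hj]
    ring
  · simp

theorem form_comm {ε : ι → ℝ} (hε : ∀ i j, A.a i j * ε j = A.a j i * ε i) (x y : ι → ℝ) :
    A.form ε x y = A.form ε y x := by
  simp only [form_apply, simpleRoot_apply, Finset.mul_sum]
  rw [Finset.sum_comm]
  refine Finset.sum_congr rfl fun i _ => Finset.sum_congr rfl fun j _ => ?_
  linear_combination (x j * y i) * hε i j

theorem form_rho {ε : ι → ℝ} (hε : ∀ i j, A.a i j * ε j = A.a j i * ε i) (w : A.WeylGroup)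
    (x y : ι → ℝ) : A.form ε (A.rho w x) (A.rho w y) = A.form ε x y := by
  induction w using A.cs.simple_induction_left with
  | one => rw [rho_one, rho_one]
  | mul_simple_left w i ih =>
    rw [rho_mul, rho_mul, rho_simple, rho_simple, ← ih]
    simp only [map_sub, LinearMap.sub_apply, map_smul, LinearMap.smul_apply, smul_eq_mul]
    rw [A.form_comm hε (A.rho w x) (coroot i)]
    simp only [form_coroot_left, simpleRoot_coroot, A.diag]
    push_cast
    ring

/-- By invariance of the form, $\varepsilon_j\alpha_j(wu)$ is the pairing of $w^{-1}h_j$ with $u$,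
and an antidominant $u$ pairs non-positively with non-negative vectors. -/
theorem simpleRoot_rho_nonpos {ε : ι → ℝ} (hε0 : ∀ i, 0 < ε i)
    (hε : ∀ i j, A.a i j * ε j = A.a j i * ε i) {w : A.WeylGroup} {u : ι → ℝ}
    (hu : ∀ i, A.simpleRoot i u ≤ 0) {j : ι} (hj : 0 ≤ A.rho w⁻¹ (coroot j)) :
    A.simpleRoot j (A.rho w u) ≤ 0 := by
  have h1 : ε j * A.simpleRoot j (A.rho w u) ≤ 0 := by
    rw [← form_coroot_left, ← A.form_rho hε w⁻¹, rho_inv_rho, form_apply]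
    exact Finset.sum_nonpos fun i _ => mul_nonpos_of_nonneg_of_nonpos (hε0 i).le
      (mul_nonpos_of_nonneg_of_nonpos (hj i) (hu i))
  exact nonpos_of_mul_nonpos_right h1 (hε0 j)

/-- The right side minus the left is $-\frac12\sum G_{ij}(r_i-r_j)^2$, where $G$ is symmetric with
non-positive off-diagonal entries. If $Av>0$ on the support of $v$, the form is positive definite
there. -/
theorem sum_sq_le_form {ε : ι → ℝ} (hε0 : ∀ i, 0 < ε i)
    (hε : ∀ i j, A.a i j * ε j = A.a j i * ε i) {v : ι → ℝ} (hv : 0 ≤ v) (r : ι → ℝ) :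
    ∑ i, r i ^ 2 * (v i / ε i * ∑ j, A.a i j * v j) ≤
      A.form ε (fun i => r i * (v i / ε i)) (fun i => r i * (v i / ε i)) := by
  set t : ι → ℝ := fun i => v i / ε i with ht
  have ht0 : ∀ i, 0 ≤ t i := fun i => div_nonneg (hv i) (hε0 i).le
  have hvt : ∀ i, v i = ε i * t i := fun i => by
    rw [ht]
    have := (hε0 i).ne'
    field_simp
  set G : ι → ι → ℝ := fun i j => A.a i j * ε j * (t i * t j) with hG
  have hGs : ∀ i j, G i j = G j i := fun i j => by
    simp only [hG]
    rw [hε i j]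
    ring
  have h1 : ∑ i, r i ^ 2 * (t i * ∑ j, A.a i j * v j) = ∑ i, ∑ j, G i j * r i ^ 2 := by
    refine Finset.sum_congr rfl fun i _ => ?_
    rw [Finset.mul_sum, Finset.mul_sum]
    refine Finset.sum_congr rfl fun j _ => ?_
    rw [hvt j]
    ring
  have h2 : ∑ i, ∑ j, G i j * r i ^ 2 = ∑ i, ∑ j, G i j * r j ^ 2 := by
    rw [Finset.sum_comm]
    refine Finset.sum_congr rfl fun i _ => Finset.sum_congr rfl fun j _ => ?_
    rw [hGs]
  have h3 : A.form ε (fun i => r i * t i) (fun i => r i * t i) =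
      ∑ i, ∑ j, G i j * (r i * r j) := by
    rw [form_apply]
    refine Finset.sum_congr rfl fun i _ => ?_
    rw [simpleRoot_apply, Finset.mul_sum, Finset.mul_sum]
    refine Finset.sum_congr rfl fun j _ => ?_
    simp only [hG]
    linear_combination (-(r i * t i * r j * t j)) * hε i j
  have h4 : ∑ i, ∑ j, G i j * r i ^ 2 + ∑ i, ∑ j, G i j * r j ^ 2 ≤
      2 * ∑ i, ∑ j, G i j * (r i * r j) := by
    rw [Finset.mul_sum, ← Finset.sum_add_distrib]
    refine Finset.sum_le_sum fun i _ => ?_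
    rw [Finset.mul_sum, ← Finset.sum_add_distrib]
    refine Finset.sum_le_sum fun j _ => ?_
    by_cases hij : i = j
    · subst hij
      exact le_of_eq (by ring)
    · have h5 : G i j ≤ 0 := mul_nonpos_of_nonpos_of_nonneg
        (mul_nonpos_of_nonpos_of_nonneg (by exact_mod_cast A.nonpos i j hij) (hε0 j).le)
        (mul_nonneg (ht0 i) (ht0 j))
      nlinarith [mul_nonpos_of_nonpos_of_nonneg h5 (sq_nonneg (r i - r j))]
  rw [h1, h3]
  linarith

/-- A coroot conjugate to $h_k$ has norm $2\varepsilon_k$ in a form that is positive definite on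
$\mathbb R^K$, so the coroots are integer vectors in a bounded box. -/
theorem finite_posCoroots (hA : A.IsSymmetrizable) {K : Set ι} {v : ι → ℝ}
    (hv1 : ∀ k ∈ K, 0 < v k) (hv2 : ∀ k ∉ K, v k = 0)
    (hv3 : ∀ k ∈ K, 0 < ∑ j, A.a k j * v j) : (A.posCoroots K).Finite := by
  obtain ⟨ε, hε0, hε⟩ := hA.exists_symmetrizer
  have hv : 0 ≤ v := IsAntidominantSupport.nonneg hv1 hv2
  -- For $i\in K$ the norm is at least $m_i d_i^2$, and $\sum_j2\varepsilon_j$ bounds all norms at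
  -- once. Outside $K$ the value is meaningless, but $d_i=0\le|C_i|+1$ still holds.
  let m : ι → ℝ := fun i => (∑ j, A.a i j * v j) * ε i / v i
  let C : ι → ℝ := fun i => (∑ j, 2 * ε j) / m i
  have hfin := (Set.finite_Icc (0 : ι → ℤ) fun i => ⌈|C i| + 1⌉).image
    fun (d : ι → ℤ) (i : ι) => (d i : ℝ)
  refine hfin.subset ?_
  rintro β ⟨⟨w, hw, k, hk, rfl⟩, hβ⟩
  have hβK : ∀ i ∉ K, A.rho w (coroot k) i = 0 := fun i hi => by
    rw [A.rho_apply_of_notMem hw _ hi, coroot_of_ne (by rintro rfl; exact hi hk)]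
  obtain ⟨d, hd⟩ := A.exists_int_rho_coroot w k
  have hnorm : A.form ε (A.rho w (coroot k)) (A.rho w (coroot k)) ≤ ∑ j, 2 * ε j := by
    rw [A.form_rho hε, form_coroot_left, simpleRoot_coroot, A.diag, mul_comm]
    exact_mod_cast Finset.single_le_sum (f := fun j => 2 * ε j)
      (fun j _ => mul_nonneg zero_le_two (hε0 j).le) (Finset.mem_univ k)
  rw [hd] at hnorm hβ hβK ⊢
  refine ⟨d, ⟨fun i => Int.cast_nonneg_iff.1 (hβ i), fun i => ?_⟩, rfl⟩
  suffices h : (d i : ℝ) ≤ |C i| + 1 by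
    exact_mod_cast h.trans (Int.le_ceil _)
  by_cases hi : i ∈ K
  · have hr : (fun i => (d i : ℝ)) = fun i => (d i / (v i / ε i) : ℝ) * (v i / ε i) := by
      funext i
      by_cases hi : i ∈ K
      · have := (hv1 i hi).ne'
        have := (hε0 i).ne'
        field_simp
      · have : (d i : ℝ) = 0 := hβK i hi
        simp [this]
    have h1 := A.sum_sq_le_form hε0 hε hv fun i => (d i / (v i / ε i) : ℝ)
    rw [← hr] at h1
    have h2 : (d i / (v i / ε i) : ℝ) ^ 2 * (v i / ε i * ∑ j, A.a i j * v j) ≤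
        ∑ i, (d i / (v i / ε i) : ℝ) ^ 2 * (v i / ε i * ∑ j, A.a i j * v j) := by
      refine Finset.single_le_sum (f := fun i =>
        (d i / (v i / ε i) : ℝ) ^ 2 * (v i / ε i * ∑ j, A.a i j * v j)) (fun l _ => ?_)
        (Finset.mem_univ i)
      by_cases hl : l ∈ K
      · exact mul_nonneg (sq_nonneg _)
          (mul_nonneg (div_nonneg (hv l) (hε0 l).le) (hv3 l hl).le)
      · simp [hv2 l hl]
    have h3 : (d i / (v i / ε i) : ℝ) ^ 2 * (v i / ε i * ∑ j, A.a i j * v j) =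
        (d i : ℝ) ^ 2 * m i := by
      have := (hv1 i hi).ne'
      have := (hε0 i).ne'
      simp only [m]
      field_simp
    have hm : 0 < m i := div_pos (mul_pos (hv3 i hi) (hε0 i)) (hv1 i hi)
    have h4 : (d i : ℝ) ^ 2 ≤ C i := by
      rw [le_div_iff₀ hm, ← h3]
      exact h2.trans (h1.trans hnorm)
    have h5 := le_abs_self (C i)
    nlinarith [hβ i, sq_nonneg ((d i : ℝ) - 1), abs_nonneg (C i)]
  · have := hβK i hi
    simp only at this
    rw [this]
    positivity

end Form

end GCM

namespace GCM

/-! ### The Tits cone and the classification of its faces. -/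

namespace Realization

variable {ι : Type*} {A : GCM ι} [Fintype ι] [DecidableEq ι] {H : Type*} [AddCommGroup H]
  [Module.Free ℤ H] [Module.Finite ℤ H] (D : A.Realization H)

/-- The evaluation of `λ` on the coroot combination `∑ c i • h_i`. -/
noncomputable def eval (l : D.V) : (ι → ℝ) →ₗ[ℝ] ℝ :=
  ∑ i, l (D.h i) • LinearMap.proj i

theorem eval_apply (l : D.V) (c : ι → ℝ) : D.eval l c = ∑ i, l (D.h i) * c i := by
  simp [eval]

theorem eval_coroot (l : D.V) (i : ι) : D.eval l (coroot i) = l (D.h i) := by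
  simp [eval_apply, coroot, Pi.single_apply]

theorem eval_add (l m : D.V) (c : ι → ℝ) : D.eval (l + m) c = D.eval l c + D.eval m c := by
  simp [eval_apply, add_mul, Finset.sum_add_distrib]

theorem eval_smul (a : ℝ) (l : D.V) (c : ι → ℝ) : D.eval (a • l) c = a * D.eval l c := by
  simp [eval_apply, Finset.mul_sum, mul_assoc]

theorem eval_act_simple (i : ι) (l : D.V) (c : ι → ℝ) :
    D.eval (D.act (A.cs.simple i) l) c = D.eval l (A.rho (A.cs.simple i) c) := by
  have h1 : ∀ k, D.act (A.cs.simple i) l (D.h k) = l (D.h k) - l (D.h i) * A.a k i := fun k => by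
    rw [← D.pairing i k]
    exact D.act_simple i l (D.h k)
  rw [rho_simple, map_sub, map_smul, eval_coroot, eval_apply, eval_apply, simpleRoot_apply,
    smul_eq_mul, Finset.sum_mul, ← Finset.sum_sub_distrib]
  refine Finset.sum_congr rfl fun k _ => ?_
  rw [h1]
  ring

theorem eval_act (w : A.WeylGroup) (l : D.V) (c : ι → ℝ) :
    D.eval (D.act w l) c = D.eval l (A.rho w⁻¹ c) := by
  induction w using A.cs.simple_induction_left generalizing c with
  | one => rw [act_one, inv_one, rho_one]
  | mul_simple_left w i ih =>
    rw [act_mul, eval_act_simple, ih, mul_inv_rev, CoxeterSystem.inv_simple, rho_mul]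

theorem act_apply_h (w : A.WeylGroup) (l : D.V) (i : ι) :
    D.act w l (D.h i) = D.eval l (A.rho w⁻¹ (coroot i)) := by
  rw [← eval_coroot, eval_act]

theorem eval_eq_zero {Θ : Set ι} {l : D.V} (hl : ∀ i ∈ Θ, l (D.h i) = 0) {c : ι → ℝ}
    (hc : ∀ i ∉ Θ, c i = 0) : D.eval l c = 0 := by
  rw [eval_apply]
  refine Finset.sum_eq_zero fun i _ => ?_
  by_cases hi : i ∈ Θ
  · rw [hl i hi, zero_mul]
  · rw [hc i hi, mul_zero]

theorem eval_nonneg_of_dominant {Θ : Set ι} {l : D.V} (hl : ∀ i ∈ Θ, 0 ≤ l (D.h i)) {c : ι → ℝ}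
    (hc : 0 ≤ c) (hcΘ : ∀ i ∉ Θ, c i = 0) : 0 ≤ D.eval l c := by
  rw [eval_apply]
  refine Finset.sum_nonneg fun i _ => ?_
  by_cases hi : i ∈ Θ
  · exact mul_nonneg (hl i hi) (hc i)
  · rw [hcΘ i hi, mul_zero]

theorem eval_nonneg_of_mem_chamber {l : D.V} (hl : l ∈ D.chamber) {c : ι → ℝ} (hc : 0 ≤ c) :
    0 ≤ D.eval l c :=
  D.eval_nonneg_of_dominant (Θ := Set.univ) (fun i _ => hl i) hc fun _ hi => absurd trivial hi

theorem apply_h_eq_zero_of_eval_eq_zero {Θ : Set ι} {l : D.V} (hl : ∀ i ∈ Θ, 0 ≤ l (D.h i))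
    {c : ι → ℝ} (hc : 0 ≤ c) (hcΘ : ∀ i ∉ Θ, c i = 0) (h : D.eval l c = 0) {i : ι}
    (hi : c i ≠ 0) : l (D.h i) = 0 := by
  rw [eval_apply, Finset.sum_eq_zero_iff_of_nonneg] at h
  · exact (mul_eq_zero.1 (h i (Finset.mem_univ i))).resolve_right hi
  · intro i _
    by_cases hi : i ∈ Θ
    · exact mul_nonneg (hl i hi) (hc i)
    · rw [hcΘ i hi, mul_zero]

theorem act_eq_self {J : Set ι} {w : A.WeylGroup} (hw : w ∈ A.parabolic J) {l : D.V}
    (hl : ∀ j ∈ J, l (D.h j) = 0) : D.act w l = l := by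
  induction hw using A.parabolic_induction with
  | one => exact D.act_one l
  | mul i hi w hw ih =>
    rw [act_mul, ih]
    refine LinearMap.ext fun x => (D.act_simple i l x).trans ?_
    rw [hl i hi, zero_mul, sub_zero]

/-- The positive real coroots of `W_J` on which `λ` is negative. -/
def negCoroots (J : Set ι) (l : D.V) : Set (ι → ℝ) := {β | β ∈ A.posCoroots J ∧ D.eval l β < 0}

theorem finite_negCoroots_mono {J K : Set ι} (h : J ⊆ K) {l : D.V}
    (hl : (D.negCoroots K l).Finite) : (D.negCoroots J l).Finite :=
  hl.subset fun _ hβ => ⟨A.posCoroots_mono h hβ.1, hβ.2⟩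

theorem mapsTo_negCoroots {J : Set ι} {i : ι} (hi : i ∈ J) (l : D.V) {β : ι → ℝ}
    (hβ : β ∈ D.negCoroots J (D.act (A.cs.simple i) l)) (h : β ≠ coroot i) :
    A.rho (A.cs.simple i) β ∈ D.negCoroots J l :=
  ⟨A.rho_simple_mem_posCoroots hβ.1 hi h, by rw [← eval_act_simple]; exact hβ.2⟩

theorem finite_negCoroots_act {J : Set ι} {i : ι} (hi : i ∈ J) {l : D.V}
    (hl : (D.negCoroots J l).Finite) : (D.negCoroots J (D.act (A.cs.simple i) l)).Finite := by
  refine ((hl.image (A.rho (A.cs.simple i))).insert (coroot i)).subset fun β hβ => ?_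
  by_cases h : β = coroot i
  · exact Or.inl h
  · refine Or.inr ⟨_, D.mapsTo_negCoroots hi l hβ h, ?_⟩
    rw [← rho_mul, CoxeterSystem.simple_mul_simple_self, rho_one]

/-- An element that is negative on only finitely many positive coroots of `W_J` is conjugate to a
`J`-dominant one. -/
theorem exists_act_dominant {J : Set ι} {l : D.V} (hl : (D.negCoroots J l).Finite) :
    ∃ b ∈ A.parabolic J, ∀ j ∈ J, 0 ≤ D.act b l (D.h j) := by
  induction hn : (D.negCoroots J l).ncard using Nat.strong_induction_on generalizing l with
  | _ n IH =>
  by_cases h : ∀ j ∈ J, 0 ≤ l (D.h j)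
  · exact ⟨1, one_mem _, by simpa only [act_one] using h⟩
  push Not at h
  obtain ⟨i, hi, hneg⟩ := h
  -- Reflecting in an $h_i$ on which $\lambda$ is negative removes $h_i$ from the negative coroots,
  -- while $\sigma_i$ injects the new ones into the remaining old ones.
  have hlt : (D.negCoroots J (D.act (A.cs.simple i) l)).ncard < (D.negCoroots J l).ncard := by
    have hmem : coroot i ∈ D.negCoroots J l :=
      ⟨A.coroot_mem_posCoroots hi, by rwa [eval_coroot]⟩
    rw [← Set.ncard_image_of_injective _ (A.rho_injective (A.cs.simple i))]
    refine Set.ncard_lt_ncard ⟨?_, fun hsub => ?_⟩ hl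
    · rintro _ ⟨β, hβ, rfl⟩
      refine D.mapsTo_negCoroots hi l hβ ?_
      rintro rfl
      have := hβ.2
      rw [eval_act_simple, rho_simple_coroot, map_neg, eval_coroot] at this
      linarith
    · obtain ⟨β, hβ, h1⟩ := hsub hmem
      have h2 := congrArg (A.rho (A.cs.simple i)) h1
      rw [← rho_mul, CoxeterSystem.simple_mul_simple_self, rho_one, rho_simple_coroot] at h2
      have h3 := hβ.1.2 i
      rw [h2, Pi.neg_apply, coroot_self] at h3
      norm_num at h3
  obtain ⟨b, hb, h1⟩ := IH _ (hn ▸ hlt) (D.finite_negCoroots_act hi hl) rfl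
  exact ⟨b * A.cs.simple i, mul_mem hb (A.simple_mem_parabolic hi), by
    simpa only [act_mul] using h1⟩

/-- This intrinsic description makes convexity evident: a coroot negative on a convex combination is
negative on one of the two points. -/
theorem mem_titsCone_iff {l : D.V} :
    l ∈ D.titsCone ↔ (D.negCoroots Set.univ l).Finite := by
  constructor
  · rintro ⟨w, m, hm, rfl⟩
    induction w using A.cs.simple_induction_left with
    | one =>
      convert Set.finite_empty (α := ι → ℝ)
      refine Set.eq_empty_of_forall_notMem fun β hβ => hβ.2.not_ge ?_
      rw [act_one]
      exact D.eval_nonneg_of_mem_chamber hm hβ.1.2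
    | mul_simple_left w i ih =>
      rw [act_mul]
      exact D.finite_negCoroots_act (Set.mem_univ i) ih
  · intro h
    obtain ⟨b, -, hb⟩ := D.exists_act_dominant h
    exact ⟨b⁻¹, D.act b l, fun i => hb i (Set.mem_univ i), (D.act_inv_act b l).symm⟩

theorem convex_titsCone : Convex ℝ D.titsCone := by
  intro x hx y hy a b ha hb _
  rw [mem_titsCone_iff] at hx hy ⊢
  refine (hx.union hy).subset fun β hβ => ?_
  by_contra h
  rw [Set.mem_union, not_or] at h
  have h1 : 0 ≤ D.eval x β := not_lt.1 fun h' => h.1 ⟨hβ.1, h'⟩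
  have h2 : 0 ≤ D.eval y β := not_lt.1 fun h' => h.2 ⟨hβ.1, h'⟩
  have h3 := hβ.2
  rw [eval_add, eval_smul, eval_smul] at h3
  exact h3.not_ge (add_nonneg (mul_nonneg ha h1) (mul_nonneg hb h2))

theorem chamber_subset_titsCone : D.chamber ⊆ D.titsCone := fun m hm =>
  ⟨1, m, hm, (D.act_one m).symm⟩

theorem zero_mem_titsCone : (0 : D.V) ∈ D.titsCone :=
  D.chamber_subset_titsCone fun _ => le_rfl

theorem isFace_titsCone : D.IsFace D.titsCone :=
  ⟨⟨0, D.zero_mem_titsCone⟩, D.convex_titsCone, subset_rfl, fun _ hx _ _ _ _ _ => hx⟩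

/-- Pulling $u$ back to the chamber replaces it by $w^{-1}u\ge u\ge0$. -/
theorem eval_nonneg_of_antidominant {u : ι → ℝ} (hu : 0 ≤ u) (hua : ∀ j, A.simpleRoot j u ≤ 0)
    {l : D.V} (hl : l ∈ D.titsCone) : 0 ≤ D.eval l u := by
  obtain ⟨w, m, hm, rfl⟩ := hl
  rw [eval_act]
  exact D.eval_nonneg_of_mem_chamber hm (hu.trans (A.le_rho_of_antidominant hua w⁻¹).1)

/-- `R(Θ)` is the face of the Tits cone exposed by an antidominant `u` with support `Θ`. -/
theorem mem_faceSet_iff {Θ : Set ι} {u : ι → ℝ} (h1 : ∀ i ∈ Θ, 0 < u i) (h2 : ∀ i ∉ Θ, u i = 0)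
    (h3 : ∀ j, A.simpleRoot j u ≤ 0) {l : D.V} :
    l ∈ D.faceSet Θ ↔ l ∈ D.titsCone ∧ D.eval l u = 0 := by
  refine ⟨fun h => ⟨h.1, D.eval_eq_zero h.2 h2⟩, fun ⟨hl, hl0⟩ => ⟨hl, ?_⟩⟩
  have hu := IsAntidominantSupport.nonneg h1 h2
  -- Make $\lambda$ dominant on $\Theta$ by some $b\in\mathcal W_\Theta$. As $bu-u$ and $u$ are
  -- non-negative and supported on $\Theta$, and $b\lambda$ kills their sum, it kills $u$ and hence
  -- all $h_i$, $i\in\Theta$. Then $b$ fixes the point.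
  obtain ⟨b, hb, hdom⟩ := D.exists_act_dominant
    (D.finite_negCoroots_mono (Set.subset_univ Θ) (D.mem_titsCone_iff.1 hl))
  have h4 : D.eval (D.act b l) (A.rho b u) = 0 := by rw [eval_act, rho_inv_rho, hl0]
  have h5 : 0 ≤ D.eval (D.act b l) (A.rho b u - u) :=
    D.eval_nonneg_of_dominant hdom (sub_nonneg.2 (A.le_rho_of_antidominant h3 b).1)
      fun i hi => by rw [Pi.sub_apply, A.rho_apply_of_notMem hb u hi, sub_self]
  have h6 : 0 ≤ D.eval (D.act b l) u := D.eval_nonneg_of_dominant hdom hu h2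
  rw [map_sub, h4] at h5
  have h7 : ∀ i ∈ Θ, D.act b l (D.h i) = 0 := fun i hi =>
    D.apply_h_eq_zero_of_eval_eq_zero hdom hu h2 (by linarith) (h1 i hi).ne'
  rwa [← D.act_eq_self (inv_mem hb) h7, act_inv_act] at h7

theorem isFace_faceSet {Θ : Set ι} (hΘ : A.IsAntidominantSupport Θ) :
    D.IsFace (D.faceSet Θ) := by
  obtain ⟨u, h1, h2, h3⟩ := hΘ
  have hu := IsAntidominantSupport.nonneg h1 h2
  refine ⟨⟨0, D.zero_mem_titsCone, fun i _ => rfl⟩, ?_, fun l hl => hl.1, ?_⟩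
  · rintro x ⟨hx, hx0⟩ y ⟨hy, hy0⟩ a b ha hb hab
    refine ⟨D.convex_titsCone hx hy ha hb hab, fun i hi => ?_⟩
    simp [hx0 i hi, hy0 i hi]
  · rintro x hx y hy z hz ⟨a, b, ha, hb, -, rfl⟩
    rw [D.mem_faceSet_iff h1 h2 h3] at hz ⊢
    refine ⟨hx, ?_⟩
    have h4 := hz.2
    have h5 := D.eval_nonneg_of_antidominant hu h3 hx
    have h6 := D.eval_nonneg_of_antidominant hu h3 hy
    rw [eval_add, eval_smul, eval_smul] at h4
    have h7 := mul_nonneg ha.le h5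
    have h8 := mul_nonneg hb.le h6
    exact (mul_eq_zero.1 (by linarith)).resolve_left ha.ne'

theorem mem_parabolic_of_act_mem_chamber {m : D.V} (hm : m ∈ D.chamber) {w : A.WeylGroup}
    (hw : D.act w m ∈ D.chamber) : w ∈ A.parabolic {i | m (D.h i) = 0} := by
  induction hn : A.cs.length w using Nat.strong_induction_on generalizing w with
  | _ n IH =>
  by_cases h1 : w = 1
  · rw [h1]
    exact one_mem _
  obtain ⟨i, hi⟩ := A.cs.exists_rightDescent_of_ne_one h1
  have h2 := D.eval_nonneg_of_mem_chamber hw (neg_nonneg.2 (A.rho_coroot_nonpos w i hi))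
  rw [map_neg, eval_act, rho_inv_rho, eval_coroot] at h2
  have h3 : m (D.h i) = 0 := le_antisymm (by linarith) (hm i)
  have h4 : A.cs.simple i ∈ A.parabolic {i | m (D.h i) = 0} := A.simple_mem_parabolic h3
  have h5 := IH _ (hn ▸ hi) (w := w * A.cs.simple i)
    (by rwa [act_mul, D.act_eq_self h4 fun _ h => h]) rfl
  have h6 := mul_mem h5 h4
  rwa [CoxeterSystem.simple_mul_simple_cancel_right] at h6

/-- The sum of the fundamental weights $\Lambda_i$ over $i\notin\Theta$ is a generic point of
$R(\Theta)$. -/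
theorem exists_mem_chamber_eq_zero_iff (Θ : Set ι) :
    ∃ m ∈ D.chamber, ∀ i, m (D.h i) = 0 ↔ i ∈ Θ := by
  classical
  obtain ⟨Λ, hΛ⟩ := D.exists_fundamental
  let m : D.V := ∑ i with i ∉ Θ, (Int.castAddHom ℝ).toIntLinearMap ∘ₗ Λ i
  have hm : ∀ j, m (D.h j) = if j ∈ Θ then 0 else 1 := fun j => by
    simp [m, LinearMap.sum_apply, hΛ]
  refine ⟨m, fun i => ?_, fun i => ?_⟩
  · rw [hm]
    split_ifs <;> norm_num
  · rw [hm]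
    split_ifs <;> simpa

theorem mem_pointwiseStabilizer_faceSet {Θ : Set ι} {w : A.WeylGroup} :
    w ∈ D.pointwiseStabilizer (D.faceSet Θ) ↔ w ∈ A.parabolic Θ := by
  refine ⟨fun h => ?_, fun h l hl => D.act_eq_self h hl.2⟩
  obtain ⟨m, hm, hmΘ⟩ := D.exists_mem_chamber_eq_zero_iff Θ
  have h1 := h m ⟨D.chamber_subset_titsCone hm, fun i hi => (hmΘ i).2 hi⟩
  have h2 := D.mem_parabolic_of_act_mem_chamber hm (w := w) (by rwa [h1])
  refine A.parabolic_mono (fun i hi => ?_) h2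
  exact (hmΘ i).1 hi

/-- A generic chamber point $m$ of $R(\Theta)$ annihilates $g^{-1}u\ge0$ and is strictly positive on
each $h_i$ with $i\notin\Theta$. -/
theorem rho_inv_eq_zero_of_image_subset {Θ Θ' : Set ι} {u : ι → ℝ} (h1 : ∀ i ∈ Θ', 0 < u i)
    (h2 : ∀ i ∉ Θ', u i = 0) (h3 : ∀ j, A.simpleRoot j u ≤ 0) {g : A.WeylGroup}
    (hg : D.act g '' D.faceSet Θ ⊆ D.faceSet Θ') : ∀ i ∉ Θ, A.rho g⁻¹ u i = 0 := by
  obtain ⟨m, hm, hmΘ⟩ := D.exists_mem_chamber_eq_zero_iff Θ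
  have h4 := hg ⟨m, ⟨D.chamber_subset_titsCone hm, fun i hi => (hmΘ i).2 hi⟩, rfl⟩
  have h5 := D.eval_eq_zero h4.2 h2
  rw [eval_act] at h5
  have h6 : 0 ≤ A.rho g⁻¹ u :=
    (IsAntidominantSupport.nonneg h1 h2).trans (A.le_rho_of_antidominant h3 g⁻¹).1
  intro i hi
  by_contra h7
  exact hi ((hmΘ i).1 (D.apply_h_eq_zero_of_eval_eq_zero (Θ := Set.univ) (fun i _ => hm i) h6
    (fun i hi => absurd trivial hi) h5 h7))

theorem subset_of_image_faceSet_subset {Θ Θ' : Set ι} (hΘ' : A.IsAntidominantSupport Θ')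
    {g : A.WeylGroup} (hg : D.act g '' D.faceSet Θ ⊆ D.faceSet Θ') : Θ' ⊆ Θ := by
  obtain ⟨u, h1, h2, h3⟩ := hΘ'
  intro i hi
  by_contra h
  have h4 := (A.le_rho_of_antidominant h3 g⁻¹).1 i
  rw [D.rho_inv_eq_zero_of_image_subset h1 h2 h3 hg i h] at h4
  exact h4.not_gt (h1 i hi)

/-- Write $g^{-1}=ba$ with $b\in\mathcal W_\Theta$ and $a$ minimal in $\mathcal W_\Theta a$. Then
$au$ is supported on $\Theta$ and again antidominant. Both $u$ and $au$ are least in the same orbit,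
so $au=u$, and $a$ lies in the parabolic subgroup of the $i$ with $\alpha_i(u)=0$; these belong to
$\Theta\cup\Theta^\bot$. -/
theorem mem_parabolic_of_image_faceSet_subset (hA : A.IsSymmetrizable) {Θ : Set ι}
    (hΘ : A.IsAntidominantSupport Θ) {g : A.WeylGroup}
    (hg : D.act g '' D.faceSet Θ ⊆ D.faceSet Θ) : g ∈ A.parabolic (Θ ∪ A.perp Θ) := by
  obtain ⟨ε, hε0, hε⟩ := hA.exists_symmetrizer
  obtain ⟨u, h1, h2, h3⟩ := hΘ
  have hu := IsAntidominantSupport.nonneg h1 h2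
  have h4 := D.rho_inv_eq_zero_of_image_subset h1 h2 h3 hg
  obtain ⟨b, hb, a, ha, hba⟩ := A.exists_mul_minRepsRight Θ g⁻¹
  have hy : ∀ i ∉ Θ, A.rho a u i = 0 := fun i hi => by
    have h5 : a = b⁻¹ * g⁻¹ := by rw [hba, inv_mul_cancel_left]
    rw [h5, rho_mul, A.rho_apply_of_notMem (inv_mem hb) _ hi, h4 i hi]
  have hle := (A.le_rho_of_antidominant h3 a).1
  have hanti : ∀ j, A.simpleRoot j (A.rho a u) ≤ 0 := fun j => by
    by_cases hj : j ∈ Θ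
    · exact A.simpleRoot_rho_nonpos hε0 hε h3
        (A.mem_minRepsLeft_iff.1 (A.inv_mem_minRepsLeft_iff.2 ha) j hj)
    · exact A.simpleRoot_nonpos (hu.trans hle) (hy j hj)
  have hle' := (A.le_rho_of_antidominant hanti a⁻¹).1
  rw [rho_inv_rho] at hle'
  have h6 := (A.le_rho_of_antidominant h3 a).2 (le_antisymm hle' hle)
  have h7 : a ∈ A.parabolic (Θ ∪ A.perp Θ) := by
    refine A.parabolic_mono (fun i hi => ?_) h6
    by_contra h8
    rw [Set.mem_union, not_or] at h8
    obtain ⟨j, hj, hij⟩ : ∃ j ∈ Θ, A.a i j ≠ 0 := by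
      by_contra! h9
      exact h8.2 h9
    exact (A.simpleRoot_neg hu (h2 i h8.1) (h1 j hj) fun h => hij ((A.zero_iff j i).1 h)).ne hi
  have h8 := mul_mem (A.parabolic_mono Set.subset_union_left hb) h7
  rw [← hba] at h8
  exact inv_mem_iff.1 h8

theorem act_mem_faceSet {Θ : Set ι} {g : A.WeylGroup} (hg : g ∈ A.parabolic (Θ ∪ A.perp Θ))
    {l : D.V} (hl : l ∈ D.faceSet Θ) : D.act g l ∈ D.faceSet Θ := by
  refine ⟨D.act_mem_titsCone g hl.1, fun i hi => ?_⟩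
  obtain ⟨a, ha, b, hb, hab⟩ := A.exists_mul_of_mem_parabolic_union_perp (inv_mem hg)
  rw [act_apply_h, hab, rho_mul, A.rho_coroot_eq_self_of_perp hb hi]
  refine D.eval_eq_zero hl.2 fun k hk => ?_
  rw [A.rho_apply_of_notMem ha _ hk, coroot_of_ne (by rintro rfl; exact hk hi)]

theorem image_faceSet {Θ : Set ι} {g : A.WeylGroup} (hg : g ∈ A.parabolic (Θ ∪ A.perp Θ)) :
    D.act g '' D.faceSet Θ = D.faceSet Θ := by
  refine Set.Subset.antisymm ?_ fun l hl =>
    ⟨D.act g⁻¹ l, D.act_mem_faceSet (inv_mem hg) hl, D.act_act_inv g l⟩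
  rintro _ ⟨l, hl, rfl⟩
  exact D.act_mem_faceSet hg hl

theorem act_image_mul (g w : A.WeylGroup) (S : Set D.V) :
    D.act (g * w) '' S = D.act g '' (D.act w '' S) := by
  rw [Set.image_image]
  exact Set.image_congr fun l _ => D.act_mul g w l

theorem exists_pos_forall_add_mul_nonneg {a b : ι → ℝ} (h : ∀ i, 0 < a i ∨ (a i = 0 ∧ 0 ≤ b i)) :
    ∃ t : ℝ, 0 < t ∧ ∀ i, 0 ≤ a i + t * b i := by
  have key : ∀ i, ∀ᶠ t in nhdsWithin (0 : ℝ) (Set.Ioi 0), 0 ≤ a i + t * b i := by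
    intro i
    rcases h i with h | ⟨h1, h2⟩
    · have hc : Filter.Tendsto (fun t : ℝ => a i + t * b i) (nhdsWithin 0 (Set.Ioi 0))
          (nhds (a i)) := by
        have : Continuous fun t : ℝ => a i + t * b i := by fun_prop
        have := this.tendsto 0
        rw [zero_mul, add_zero] at this
        exact this.mono_left nhdsWithin_le_nhds
      exact (hc.eventually (lt_mem_nhds h)).mono fun t ht => ht.le
    · filter_upwards [self_mem_nhdsWithin] with t ht
      rw [h1, zero_add]
      exact mul_nonneg (le_of_lt ht) h2
  obtain ⟨t, h1, h2⟩ := ((Filter.eventually_all.2 key).and self_mem_nhdsWithin).exists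
  exact ⟨t, h2, h1⟩

/-- Every point of the Tits cone lies in the relative interior of a conjugate of some `R(Θ)`. -/
theorem exists_faceSet_relative_interior (hA : A.IsSymmetrizable) {r : D.V}
    (hr : r ∈ D.titsCone) :
    ∃ (w : A.WeylGroup) (Θ : Set ι), A.IsAntidominantSupport Θ ∧ r ∈ D.act w '' D.faceSet Θ ∧
      ∀ x ∈ D.act w '' D.faceSet Θ, ∃ y ∈ D.titsCone, r ∈ openSegment ℝ x y := by
  obtain ⟨w, m, hm, rfl⟩ := hr
  obtain ⟨Θ, hΘJ, hΘ, hperp, v, hv1, hv2, hv3⟩ :=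
    A.exists_antidominantSupport_decomposition {i | m (D.h i) = 0}
  set K : Set ι := {i | m (D.h i) = 0} \ Θ with hK
  refine ⟨w, Θ, hΘ, ⟨m, ⟨D.chamber_subset_titsCone hm, fun i hi => hΘJ hi⟩, rfl⟩, ?_⟩
  rintro _ ⟨x, hx, rfl⟩
  -- Since $K$ has finitely many positive coroots, $m-x$ becomes $K$-dominant under some
  -- $b\in\mathcal W_K$, which fixes $m$. For small $t>0$ the point $m+t\,b(m-x)$ is then in the
  -- chamber, and its image $m+t(m-x)$ under $b^{-1}$ prolongs the segment from $x$ beyond $m$.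
  obtain ⟨b, hb, hdom⟩ := D.exists_act_dominant (l := m - x)
    ((A.finite_posCoroots hA hv1 hv2 hv3).subset fun β hβ => hβ.1)
  have hbm : D.act b⁻¹ m = m := D.act_eq_self (inv_mem hb) fun j hj => hj.1
  obtain ⟨t, ht, hnn⟩ := exists_pos_forall_add_mul_nonneg (a := fun i => m (D.h i))
      (b := fun i => D.act b (m - x) (D.h i)) (fun i => by
    by_cases hi : m (D.h i) = 0
    · refine Or.inr ⟨hi, ?_⟩
      by_cases hiΘ : i ∈ Θ
      · rw [act_apply_h, A.rho_coroot_eq_self_of_perp (inv_mem (A.parabolic_mono hperp hb)) hiΘ,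
          eval_coroot]
        rw [LinearMap.sub_apply, hi, hx.2 i hiΘ, sub_zero]
      · exact hdom i ⟨hi, hiΘ⟩
    · exact Or.inl (lt_of_le_of_ne (hm i) (Ne.symm hi)))
  have hy : m + t • (m - x) ∈ D.titsCone := by
    refine ⟨b⁻¹, m + t • D.act b (m - x), fun i => hnn i, ?_⟩
    rw [map_add, map_smul, act_inv_act, hbm]
  refine ⟨D.act w (m + t • (m - x)), D.act_mem_titsCone w hy,
    t / (1 + t), 1 / (1 + t), by positivity, by positivity, by field_simp; ring, ?_⟩
  rw [← map_smul, ← map_smul, ← map_add]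
  congr 1
  have h1 : t / (1 + t) = t * (1 / (1 + t)) := by ring
  have h2 : (1 / (1 + t)) * (1 + t) = 1 := by field_simp
  rw [h1]
  generalize 1 / (1 + t) = s at h2
  have h3 : (t * s) • x + s • (m + t • (m - x)) = (s * (1 + t)) • m := by module
  rw [h3, h2, one_smul]

/-- Every face of the Tits cone is conjugate to some `R(Θ)`. -/
theorem IsFace.exists_eq_image_faceSet (hA : A.IsSymmetrizable) {F : Set D.V}
    (hF : D.IsFace F) :
    ∃ (w : A.WeylGroup) (Θ : Set ι), A.IsAntidominantSupport Θ ∧ F = D.act w '' D.faceSet Θ := by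
  classical
  let P : D.V → A.WeylGroup → Set ι → Prop := fun r w Θ =>
    A.IsAntidominantSupport Θ ∧ r ∈ D.act w '' D.faceSet Θ ∧
      ∀ x ∈ D.act w '' D.faceSet Θ, ∃ y ∈ D.titsCone, r ∈ openSegment ℝ x y
  -- Choose a point of $F$ whose associated $\Theta$ has the fewest elements, that is, a most
  -- generic one.
  have hex : ∃ n, ∃ r ∈ F, ∃ w Θ, P r w Θ ∧ Θ.ncard = n := by
    obtain ⟨r, hr⟩ := hF.1
    obtain ⟨w, Θ, h⟩ := D.exists_faceSet_relative_interior hA (hF.2.2.subset hr)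
    exact ⟨_, r, hr, w, Θ, h, rfl⟩
  obtain ⟨r, hr, w, Θ, ⟨hΘ, hrw, hint⟩, hcard⟩ := Nat.find_spec hex
  have hleast : ∀ G : Set D.V, D.IsFace G → r ∈ G → D.act w '' D.faceSet Θ ⊆ G := by
    intro G hG hrG x hx
    obtain ⟨y, hy, hxy⟩ := hint x hx
    exact hG.2.2.left_mem_of_mem_openSegment
      (((D.isFace_faceSet hΘ).image D w).2.2.subset hx) hy hrG hxy
  refine ⟨w, Θ, hΘ, Set.Subset.antisymm (fun x hx => ?_) (hleast F hF hr)⟩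
  -- The face attached to the midpoint of $r$ and $x$ contains both ends, hence the least face
  -- containing $r$. This gives $\Theta'\subseteq\Theta$; minimality gives equality, so the two
  -- faces coincide and $x$ lies in the face of $r$.
  have hzs : (1 / 2 : ℝ) • r + (1 / 2 : ℝ) • x ∈ openSegment ℝ r x :=
    ⟨1 / 2, 1 / 2, by norm_num, by norm_num, by norm_num, rfl⟩
  have hzF := hF.2.1.openSegment_subset hr hx hzs
  obtain ⟨w', Θ', hΘ', hzw', hint'⟩ :=
    D.exists_faceSet_relative_interior hA (hF.2.2.subset hzF)
  have hG := (D.isFace_faceSet hΘ').image D w'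
  have hrG := hG.2.2.left_mem_of_mem_openSegment (hF.2.2.subset hr) (hF.2.2.subset hx) hzw' hzs
  have hxG := hG.2.2.left_mem_of_mem_openSegment (hF.2.2.subset hx) (hF.2.2.subset hr) hzw'
    (openSegment_symm ℝ r x ▸ hzs)
  have hsub : D.act (w'⁻¹ * w) '' D.faceSet Θ ⊆ D.faceSet Θ' := by
    rw [act_image_mul]
    rintro _ ⟨p, hp, rfl⟩
    obtain ⟨q, hq, rfl⟩ := hleast _ hG hrG hp
    rwa [act_inv_act]
  have hle : Θ.ncard ≤ Θ'.ncard := by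
    rw [hcard]
    exact Nat.find_min' hex ⟨_, hzF, w', Θ', ⟨hΘ', hzw', hint'⟩, rfl⟩
  obtain rfl : Θ' = Θ :=
    Set.eq_of_subset_of_ncard_le (D.subset_of_image_faceSet_subset hΘ' hsub) hle
  have h1 := D.image_faceSet (D.mem_parabolic_of_image_faceSet_subset hA hΘ hsub)
  rw [← h1, ← act_image_mul, mul_inv_cancel_left] at hxG
  exact hxG

end Realization

end GCM

namespace GCM

/-! ### Normal forms in the Weyl monoid. -/

namespace Realization

variable {ι : Type*} {A : GCM ι} [Fintype ι] [DecidableEq ι] {H : Type*} [AddCommGroup H]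
  [Module.Free ℤ H] [Module.Finite ℤ H] (D : A.Realization H)

theorem conj_mem_parabolic {Θ : Set ι} {n b : A.WeylGroup}
    (hn : n ∈ A.parabolic (Θ ∪ A.perp Θ)) (hb : b ∈ A.parabolic Θ) :
    n * b * n⁻¹ ∈ A.parabolic Θ := by
  obtain ⟨x, hx, y, hy, rfl⟩ := A.exists_mul_of_mem_parabolic_union_perp hn
  have h1 : x * y * b * (x * y)⁻¹ = x * b * x⁻¹ := by
    rw [mul_assoc x y b, ← A.commute_of_mem_parabolic_perp hb hy]
    group
  rw [h1]
  exact mul_mem (mul_mem hx hb) (inv_mem hx)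

theorem mk_eq_mk_iff (F G : D.Face) (w v : A.WeylGroup) :
    WeylMonoid.mk D F w = WeylMonoid.mk D G v ↔
      F.1 = G.1 ∧ v * w⁻¹ ∈ D.pointwiseStabilizer F.1 :=
  (Con.eq D.weylCon).trans (and_congr_left' Subtype.ext_iff)

theorem exists_eq_mk (x : D.WeylMonoid) : ∃ F w, x = WeylMonoid.mk D F w := by
  obtain ⟨⟨F, w⟩, rfl⟩ := Quotient.exists_rep x
  exact ⟨F, w, rfl⟩

theorem mem_pointwiseStabilizer_image {F : Set D.V} {w v : A.WeylGroup} :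
    v ∈ D.pointwiseStabilizer (D.act w '' F) ↔ w⁻¹ * v * w ∈ D.pointwiseStabilizer F := by
  constructor
  · intro h l hl
    rw [mul_assoc, act_mul, act_mul, h _ ⟨l, hl, rfl⟩, act_inv_act]
  · rintro h _ ⟨l, hl, rfl⟩
    have h1 := congrArg (D.act w) (h l hl)
    rwa [mul_assoc, act_mul, act_act_inv, act_mul] at h1

theorem ofWeyl_mul (hX : D.IsFace D.titsCone) (w v : A.WeylGroup) :
    D.ofWeyl hX (w * v) = D.ofWeyl hX w * D.ofWeyl hX v := by
  rw [ofWeyl, ofWeyl, ofWeyl, mk_mul_mk]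
  congr 1
  refine Subtype.ext ?_
  simp only [act_image_titsCone, Set.inter_self]

theorem ofWeyl_mul_e_mul_ofWeyl (hX : D.IsFace D.titsCone) (F : D.Face) (w v : A.WeylGroup) :
    D.ofWeyl hX w * D.e F * D.ofWeyl hX v =
      WeylMonoid.mk D ⟨D.act w '' F.1, F.2.image D w⟩ (w * v) := by
  rw [ofWeyl, ofWeyl, e, mk_mul_mk, mk_mul_mk, mul_one]
  congr 1
  refine Subtype.ext ?_
  simp only [act_image_titsCone]
  have h1 := (F.2.image D w).2.2.subset
  rw [Set.inter_eq_right.2 h1, Set.inter_eq_left.2 h1]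

variable (hX : D.IsFace D.titsCone) (hR : ∀ Θ : {Θ : Set ι // A.IsSpecial Θ}, D.IsFace (D.faceSet Θ))

/-- Both sides are classes of pairs $(w_1R(\Theta),w_1w_2)$. Equality of the faces gives the first
two conditions; the stabilizer condition, conjugated by $w_1$, gives the third. -/
theorem ofWeyl_mul_e_mul_ofWeyl_eq_iff (hA : A.IsSymmetrizable)
    (Θ Θ' : {Θ : Set ι // A.IsSpecial Θ}) (w₁ w₂ w₁' w₂' : A.WeylGroup) :
    D.ofWeyl hX w₁ * D.e ⟨D.faceSet Θ, hR Θ⟩ * D.ofWeyl hX w₂ =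
        D.ofWeyl hX w₁' * D.e ⟨D.faceSet Θ', hR Θ'⟩ * D.ofWeyl hX w₂' ↔
      Θ = Θ' ∧ w₁⁻¹ * w₁' ∈ A.parabolic (Θ ∪ A.perp Θ) ∧
        w₁⁻¹ * w₁' * (w₂' * w₂⁻¹) ∈ A.parabolic Θ := by
  rw [ofWeyl_mul_e_mul_ofWeyl, ofWeyl_mul_e_mul_ofWeyl, mk_eq_mk_iff,
    mem_pointwiseStabilizer_image, mem_pointwiseStabilizer_faceSet]
  have h0 : w₁⁻¹ * (w₁' * w₂' * (w₁ * w₂)⁻¹) * w₁ = w₁⁻¹ * w₁' * (w₂' * w₂⁻¹) := by group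
  rw [h0]
  refine ⟨fun ⟨h, h'⟩ => ?_, fun ⟨h1, h2, h3⟩ => ⟨?_, h3⟩⟩
  · simp only at h
    have h1 : D.act (w₁⁻¹ * w₁') '' D.faceSet Θ' = D.faceSet Θ := by
      rw [act_image_mul, ← h, ← act_image_mul, inv_mul_cancel]
      simp [act_one]
    have h2 : D.act (w₁'⁻¹ * w₁) '' D.faceSet Θ = D.faceSet Θ' := by
      rw [act_image_mul, h, ← act_image_mul, inv_mul_cancel]
      simp [act_one]
    have h3 : Θ = Θ' := Subtype.ext (Set.Subset.antisymm
      (D.subset_of_image_faceSet_subset (A.isSpecial_iff.1 Θ.2) h1.subset)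
      (D.subset_of_image_faceSet_subset (A.isSpecial_iff.1 Θ'.2) h2.subset))
    subst h3
    exact ⟨rfl, D.mem_parabolic_of_image_faceSet_subset hA (A.isSpecial_iff.1 Θ.2) h1.subset, h'⟩
  · subst h1
    simp only
    rw [← D.image_faceSet h2, ← act_image_mul, mul_inv_cancel_left, D.image_faceSet h2]

theorem exists_eq_ofWeyl_mul_e_mul_ofWeyl (hA : A.IsSymmetrizable) (x : D.WeylMonoid) :
    ∃ (Θ : {Θ : Set ι // A.IsSpecial Θ}) (w₁ w₂ : A.WeylGroup),
      x = D.ofWeyl hX w₁ * D.e ⟨D.faceSet Θ, hR Θ⟩ * D.ofWeyl hX w₂ := by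
  obtain ⟨F, v, rfl⟩ := D.exists_eq_mk x
  obtain ⟨w, Θ, hΘ, hF⟩ := F.2.exists_eq_image_faceSet D hA
  refine ⟨⟨Θ, A.isSpecial_iff.2 hΘ⟩, w, w⁻¹ * v, ?_⟩
  rw [ofWeyl_mul_e_mul_ofWeyl, mul_inv_cancel_left]
  congr 1
  exact Subtype.ext hF

theorem existsUnique_minRepsLeft_minRepsRight_union_perp (hA : A.IsSymmetrizable)
    (x : D.WeylMonoid) :
    ∃! p : {Θ : Set ι // A.IsSpecial Θ} × A.WeylGroup × A.WeylGroup,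
      p.2.1 ∈ A.minRepsLeft p.1 ∧ p.2.2 ∈ A.minRepsRight (p.1 ∪ A.perp p.1) ∧
      x = D.ofWeyl hX p.2.1 * D.e ⟨D.faceSet p.1, hR p.1⟩ * D.ofWeyl hX p.2.2 := by
  obtain ⟨Θ, w₁, w₂, rfl⟩ := D.exists_eq_ofWeyl_mul_e_mul_ofWeyl hX hR hA x
  -- The part $n$ of $w_2$ in $\mathcal W_{\Theta\cup\Theta^\bot}$ is moved to the left of the
  -- idempotent, where the $\mathcal W_\Theta$-part $b$ of $w_1n=ab$ is absorbed. Normality of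
  -- $\mathcal W_\Theta$ in $\mathcal W_{\Theta\cup\Theta^\bot}$ justifies this.
  obtain ⟨n, hn, c, hc, rfl⟩ := A.exists_mul_minRepsRight (Θ ∪ A.perp Θ) w₂
  obtain ⟨a, ha, b, hb, hab⟩ := A.exists_minRepsLeft_mul Θ (w₁ * n)
  have h1 : w₁⁻¹ * a = n * b⁻¹ := by
    rw [inv_mul_eq_iff_eq_mul, ← mul_assoc, hab, mul_inv_cancel_right]
  have heq := (D.ofWeyl_mul_e_mul_ofWeyl_eq_iff hX hR hA Θ Θ w₁ (n * c) a c).2 ⟨rfl, by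
    rw [h1]
    exact mul_mem hn (A.parabolic_mono Set.subset_union_left (inv_mem hb)), by
    rw [h1, mul_inv_rev, mul_inv_cancel_left]
    exact conj_mem_parabolic hn (inv_mem hb)⟩
  rw [heq]
  refine ⟨(Θ, a, c), ⟨ha, hc, rfl⟩, ?_⟩
  rintro ⟨Θ', a', c'⟩ ⟨ha', hc', h⟩
  obtain ⟨rfl, h2, h3⟩ := (D.ofWeyl_mul_e_mul_ofWeyl_eq_iff hX hR hA _ _ _ _ _ _).1 h
  have h4 : c' * c⁻¹ ∈ A.parabolic (Θ ∪ A.perp Θ) :=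
    (Subgroup.mul_mem_cancel_left _ h2).1 (A.parabolic_mono Set.subset_union_left h3)
  obtain rfl := A.eq_of_mem_minRepsRight hc' hc h4
  rw [mul_inv_cancel, mul_one] at h3
  obtain rfl := A.eq_of_mem_minRepsLeft ha ha' h3
  rfl

theorem existsUnique_minRepsLeft_union_perp_minRepsRight (hA : A.IsSymmetrizable)
    (x : D.WeylMonoid) :
    ∃! p : {Θ : Set ι // A.IsSpecial Θ} × A.WeylGroup × A.WeylGroup,
      p.2.1 ∈ A.minRepsLeft (p.1 ∪ A.perp p.1) ∧ p.2.2 ∈ A.minRepsRight p.1 ∧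
      x = D.ofWeyl hX p.2.1 * D.e ⟨D.faceSet p.1, hR p.1⟩ * D.ofWeyl hX p.2.2 := by
  obtain ⟨Θ, w₁, w₂, rfl⟩ := D.exists_eq_ofWeyl_mul_e_mul_ofWeyl hX hR hA x
  obtain ⟨a, ha, n, hn, rfl⟩ := A.exists_minRepsLeft_mul (Θ ∪ A.perp Θ) w₁
  -- The mirror image of form I: $n$ moves to the right of the idempotent, which absorbs the
  -- $\mathcal W_\Theta$-part of $nw_2$.
  obtain ⟨b, hb, c, hc, hbc⟩ := A.exists_mul_minRepsRight Θ (n * w₂)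
  have h1 : (a * n)⁻¹ * a = n⁻¹ := by group
  have h2 : c = b⁻¹ * n * w₂ := by rw [mul_assoc, hbc, inv_mul_cancel_left]
  have heq := (D.ofWeyl_mul_e_mul_ofWeyl_eq_iff hX hR hA Θ Θ (a * n) w₂ a c).2 ⟨rfl, by
    rw [h1]
    exact inv_mem hn, by
    rw [h1, h2, mul_inv_cancel_right]
    have h3 := conj_mem_parabolic (inv_mem hn) (inv_mem hb)
    rwa [inv_inv, mul_assoc] at h3⟩
  rw [heq]
  refine ⟨(Θ, a, c), ⟨ha, hc, rfl⟩, ?_⟩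
  rintro ⟨Θ', a', c'⟩ ⟨ha', hc', h⟩
  obtain ⟨rfl, h2, h3⟩ := (D.ofWeyl_mul_e_mul_ofWeyl_eq_iff hX hR hA _ _ _ _ _ _).1 h
  obtain rfl := A.eq_of_mem_minRepsLeft ha ha' h2
  rw [inv_mul_cancel, one_mul] at h3
  obtain rfl := A.eq_of_mem_minRepsRight hc' hc h3
  rfl

/-- Form I refined by the unique factorization of $\mathcal W^\Theta$ into $\mathcal
W^{\Theta\cup\Theta^\bot}$ and $\mathcal W_{\Theta^\bot}$. -/
theorem existsUnique_three_factors (hA : A.IsSymmetrizable) (x : D.WeylMonoid) :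
    ∃! p : {Θ : Set ι // A.IsSpecial Θ} × A.WeylGroup × A.WeylGroup × A.WeylGroup,
      p.2.1 ∈ A.minRepsLeft (p.1 ∪ A.perp p.1) ∧ p.2.2.1 ∈ A.parabolic (A.perp p.1) ∧
      p.2.2.2 ∈ A.minRepsRight (p.1 ∪ A.perp p.1) ∧
      x = D.ofWeyl hX p.2.1 * D.ofWeyl hX p.2.2.1 * D.e ⟨D.faceSet p.1, hR p.1⟩ *
        D.ofWeyl hX p.2.2.2 := by
  obtain ⟨⟨Θ, w, c⟩, ⟨hw, hc, hx⟩, huniq⟩ :=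
    D.existsUnique_minRepsLeft_minRepsRight_union_perp hX hR hA x
  obtain ⟨a, ha, b, hb, rfl⟩ := A.exists_mul_of_mem_minRepsLeft hw
  refine ⟨(Θ, a, b, c), ⟨ha, hb, hc, by rw [← ofWeyl_mul]; exact hx⟩, ?_⟩
  rintro ⟨Θ', a', b', c'⟩ ⟨ha', hb', hc', h⟩
  have h1 := huniq (Θ', a' * b', c')
    ⟨A.mul_mem_minRepsLeft ha' hb', hc', by rw [ofWeyl_mul]; exact h⟩
  simp only [Prod.mk.injEq] at h1
  obtain ⟨rfl, h2, rfl⟩ := h1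
  obtain ⟨rfl, rfl⟩ := A.eq_of_mul_eq_mul ha' hb' ha hb h2
  rfl

theorem ofWeyl_mul_e_comm (hA : A.IsSymmetrizable) (Θ : {Θ : Set ι // A.IsSpecial Θ})
    (w₁ w₃ : A.WeylGroup) {w₂ : A.WeylGroup} (hw₂ : w₂ ∈ A.parabolic (A.perp Θ)) :
    D.ofWeyl hX w₁ * D.ofWeyl hX w₂ * D.e ⟨D.faceSet Θ, hR Θ⟩ * D.ofWeyl hX w₃ =
      D.ofWeyl hX w₁ * D.e ⟨D.faceSet Θ, hR Θ⟩ * D.ofWeyl hX w₂ * D.ofWeyl hX w₃ := by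
  rw [mul_assoc (D.ofWeyl hX w₁ * D.e _), ← ofWeyl_mul, ← ofWeyl_mul,
    ofWeyl_mul_e_mul_ofWeyl_eq_iff D hX hR hA]
  have h1 : (w₁ * w₂)⁻¹ * w₁ = w₂⁻¹ := by group
  refine ⟨rfl, ?_, ?_⟩
  · rw [h1]
    exact A.parabolic_mono Set.subset_union_right (inv_mem hw₂)
  · rw [h1, mul_inv_cancel_right, inv_mul_cancel]
    exact one_mem _

end Realization

end GCM

theorem proposition2p2 {ι : Type*} [Fintype ι] [DecidableEq ι] (A : GCM ι)
    (hA : A.IsSymmetrizable) {H : Type*} [AddCommGroup H] [Module.Free ℤ H] [Module.Finite ℤ H]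
    (D : A.Realization H) :
    ∃ (hX : D.IsFace D.titsCone) (hR : ∀ Θ : {Θ : Set ι // A.IsSpecial Θ}, D.IsFace (D.faceSet Θ)),
      -- normal form I
      (∀ x : D.WeylMonoid, ∃! p : {Θ : Set ι // A.IsSpecial Θ} × A.WeylGroup × A.WeylGroup,
        p.2.1 ∈ A.minRepsLeft p.1 ∧ p.2.2 ∈ A.minRepsRight (p.1 ∪ A.perp p.1) ∧
        x = D.ofWeyl hX p.2.1 * D.e ⟨D.faceSet p.1, hR p.1⟩ * D.ofWeyl hX p.2.2) ∧
      -- normal form II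
      (∀ x : D.WeylMonoid, ∃! p : {Θ : Set ι // A.IsSpecial Θ} × A.WeylGroup × A.WeylGroup,
        p.2.1 ∈ A.minRepsLeft (p.1 ∪ A.perp p.1) ∧ p.2.2 ∈ A.minRepsRight p.1 ∧
        x = D.ofWeyl hX p.2.1 * D.e ⟨D.faceSet p.1, hR p.1⟩ * D.ofWeyl hX p.2.2) ∧
      -- normal form III
      (∀ x : D.WeylMonoid,
        ∃! p : {Θ : Set ι // A.IsSpecial Θ} × A.WeylGroup × A.WeylGroup × A.WeylGroup,
          p.2.1 ∈ A.minRepsLeft (p.1 ∪ A.perp p.1) ∧ p.2.2.1 ∈ A.parabolic (A.perp p.1) ∧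
          p.2.2.2 ∈ A.minRepsRight (p.1 ∪ A.perp p.1) ∧
          x = D.ofWeyl hX p.2.1 * D.ofWeyl hX p.2.2.1 * D.e ⟨D.faceSet p.1, hR p.1⟩ *
            D.ofWeyl hX p.2.2.2) ∧
      (∀ (Θ : {Θ : Set ι // A.IsSpecial Θ}) (w₁ w₂ w₃ : A.WeylGroup),
        w₁ ∈ A.minRepsLeft (Θ ∪ A.perp Θ) → w₂ ∈ A.parabolic (A.perp Θ) →
        w₃ ∈ A.minRepsRight (Θ ∪ A.perp Θ) →
        D.ofWeyl hX w₁ * D.ofWeyl hX w₂ * D.e ⟨D.faceSet Θ, hR Θ⟩ * D.ofWeyl hX w₃ =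
          D.ofWeyl hX w₁ * D.e ⟨D.faceSet Θ, hR Θ⟩ * D.ofWeyl hX w₂ * D.ofWeyl hX w₃) ∧
      -- the multiplication maps that link form III with forms I and II
      (∀ Θ : Set ι, A.IsSpecial Θ →
        Set.BijOn (fun p : A.WeylGroup × A.WeylGroup => p.1 * p.2)
          (A.minRepsLeft (Θ ∪ A.perp Θ) ×ˢ (A.parabolic (A.perp Θ) : Set A.WeylGroup))
          (A.minRepsLeft Θ) ∧
        Set.BijOn (fun p : A.WeylGroup × A.WeylGroup => p.1 * p.2)
          ((A.parabolic (A.perp Θ) : Set A.WeylGroup) ×ˢ A.minRepsRight (Θ ∪ A.perp Θ))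
          (A.minRepsRight Θ)) := by
  have hX := D.isFace_titsCone
  have hR : ∀ Θ : {Θ : Set ι // A.IsSpecial Θ}, D.IsFace (D.faceSet Θ) :=
    fun Θ => D.isFace_faceSet (A.isSpecial_iff.1 Θ.2)
  exact ⟨hX, hR, D.existsUnique_minRepsLeft_minRepsRight_union_perp hX hR hA,
    D.existsUnique_minRepsLeft_union_perp_minRepsRight hX hR hA,
    D.existsUnique_three_factors hX hR hA,
    fun Θ w₁ w₂ w₃ _ hw₂ _ => D.ofWeyl_mul_e_comm hX hR hA Θ w₁ w₃ hw₂,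
    fun Θ _ => ⟨A.bijOn_mul_minRepsLeft Θ, A.bijOn_mul_minRepsRight Θ⟩⟩
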